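/- All graphs are finite and simple. For a graph $H$ on $k$ vertices and a graph $G$ on $n \ge k$ vertices, let $\mathrm{ind}(H,G)$ be the probability that a uniformly random $k$-element vertex set $W \subseteq V(G)$ satisfies $G[W] \cong H$. Let $\mathrm{ind}(H,n)$ be the maximum of $\mathrm{ind}(H,G)$ over all graphs $G$ on $n$ vertices, and let $\mathrm{ind}(H) := \lim_{n\to\infty} \mathrm{ind}(H,n)$ be the inducibility of $H$ (the limit exists because $\mathrm{ind}(H,n)$ is non-increasing in $n$ for $n \ge k$). Let $m(H)$ denote the number of non-isolated vertices of $H$. **Theorem.** There exist absolute constants $\alpha > 0$ and $c$ with $2/e^2 \le c < 1/e$ such that for all positive integers $k$ and $\ell$ with $\ell \ge 2$ and every graph $H$ with $k$ vertices and $\ell$ edges satisfying $m(H) \le \alpha k$, we have $$\mathrm{ind}(H) \le c.$$ -/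

import Mathlib

open Filter Topology

namespace GraphInducibility

noncomputable section

/-- The number `m(H)` of non-isolated vertices of `H`. -/
def numNonIsolated {V : Type*} (H : SimpleGraph V) : ℕ :=
  {v : V | ¬ H.IsIsolated v}.ncard

open Classical in
/-- The `k`-element vertex sets `W` of `G` (with `k = |V(H)|`) for which `G[W]` is isomorphic
to `H`. -/
def inducedCopies {V W : Type*} [Fintype V] [Fintype W]
    (H : SimpleGraph V) (G : SimpleGraph W) : Finset (Finset W) :=
  (Finset.univ.powersetCard (Fintype.card V)).filter
    fun S => Nonempty (G.induce (S : Set W) ≃g H)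

/-- The induced density of `H` in `G`: the probability that a uniformly random `k`-element
vertex set `W` of `G` satisfies `G[W] ≅ H`, where `k = |V(H)|`.
(It is meant for `k ≤ |V(G)|`; otherwise it is `0 / 0 = 0`.) -/
def inducedDensity {V W : Type*} [Fintype V] [Fintype W]
    (H : SimpleGraph V) (G : SimpleGraph W) : ℝ :=
  ((inducedCopies H G).card : ℝ) / ((Fintype.card W).choose (Fintype.card V) : ℝ)

/-- The maximum induced density of `H` over the (finitely many) graphs `G` on `n` vertices. -/
def maxInducedDensity {V : Type*} [Fintype V] (H : SimpleGraph V) (n : ℕ) : ℝ :=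
  ⨆ G : SimpleGraph (Fin n), inducedDensity H G

/-- The inducibility of `H`: the limit of the maximum induced density over `n`-vertex graphs as
`n → ∞`. The limit exists by `tendsto_maxInducedDensity` below. -/
def inducibility {V : Type*} [Fintype V] (H : SimpleGraph V) : ℝ :=
  limUnder atTop (maxInducedDensity H)

theorem inducedDensity_le_max {V : Type*} [Fintype V] (H : SimpleGraph V) {n : ℕ}
    (G : SimpleGraph (Fin n)) : inducedDensity H G ≤ maxInducedDensity H n :=
  le_ciSup (f := fun G : SimpleGraph (Fin n) => inducedDensity H G)
    (Set.finite_range _).bddAbove G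

theorem maxInducedDensity_nonneg {V : Type*} [Fintype V] (H : SimpleGraph V) (n : ℕ) :
    0 ≤ maxInducedDensity H n :=
  le_trans (by unfold inducedDensity; positivity) (inducedDensity_le_max H (⊥ : SimpleGraph (Fin n)))

open Classical in
theorem card_filter_inducedCopies_le {V : Type*} [Fintype V] (H : SimpleGraph V) {n : ℕ}
    (G : SimpleGraph (Fin (n + 1))) (v : Fin (n + 1)) :
    ((inducedCopies H G).filter fun S => v ∉ S).card
      ≤ (inducedCopies H (G.comap v.succAbove)).card := by
  have hsub : ((inducedCopies H G).filter fun S => v ∉ S) ⊆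
      (inducedCopies H (G.comap v.succAbove)).image
        (fun S => S.map v.succAboveEmb) := by
    intro S hS
    simp only [inducedCopies, Finset.mem_filter, Finset.mem_powersetCard, Finset.subset_univ,
      true_and] at hS
    obtain ⟨⟨hc, ⟨φ⟩⟩, hv⟩ := hS
    obtain ⟨T, rfl⟩ : ∃ T : Finset (Fin n), T.map v.succAboveEmb = S := by
      refine ⟨Finset.univ.filter fun i => v.succAbove i ∈ S, ?_⟩
      ext x
      simp only [Finset.mem_map, Finset.mem_filter, Finset.mem_univ, true_and,
        Fin.coe_succAboveEmb]
      constructor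
      · rintro ⟨a, ha, rfl⟩; exact ha
      · intro hx
        obtain ⟨y, rfl⟩ := Fin.exists_succAbove_eq (x := x) (y := v) (by rintro rfl; exact hv hx)
        exact ⟨y, hx, rfl⟩
    refine Finset.mem_image.2 ⟨T, ?_, rfl⟩
    simp only [inducedCopies, Finset.mem_filter, Finset.mem_powersetCard, Finset.subset_univ,
      true_and]
    have himg : v.succAbove '' (T : Set (Fin n)) = ((T.map v.succAboveEmb : Finset _) : Set _) := by
      ext x; simp
    refine ⟨by simpa using hc, ⟨RelIso.trans (RelIso.mk ?_ ?_) φ⟩⟩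
    · exact ((Equiv.Set.image v.succAbove (T : Set (Fin n))
        Fin.succAbove_right_injective).trans (Equiv.setCongr himg))
    · intro a b
      exact Iff.rfl
  exact (Finset.card_le_card hsub).trans Finset.card_image_le

open Classical in
theorem maxInducedDensity_succ_le {V : Type*} [Fintype V] (H : SimpleGraph V) {n : ℕ}
    (hn : Fintype.card V ≤ n) : maxInducedDensity H (n + 1) ≤ maxInducedDensity H n := by
  refine ciSup_le fun G => ?_
  set k := Fintype.card V with hk
  have hcount : (n + 1 - k) * (inducedCopies H G).card =
      ∑ v : Fin (n + 1), ((inducedCopies H G).filter fun S => v ∉ S).card := by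
    simp only [Finset.card_filter]
    rw [Finset.sum_comm]
    rw [Finset.sum_congr rfl (g := fun _ => n + 1 - k)]
    · simp [mul_comm]
    · intro S hS
      simp only [inducedCopies, Finset.mem_filter, Finset.mem_powersetCard] at hS
      rw [← Finset.card_filter]
      have : (Finset.univ.filter fun v : Fin (n + 1) => v ∉ S) = Sᶜ := by ext; simp
      rw [this, Finset.card_compl, hS.1.2, Fintype.card_fin]
  have hpos : (0 : ℝ) < (n.choose k : ℝ) := by exact_mod_cast Nat.choose_pos hn
  have hpos' : (0 : ℝ) < ((n + 1).choose k : ℝ) := by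
    exact_mod_cast Nat.choose_pos (hn.trans n.le_succ)
  have hle : ((n + 1 - k : ℕ) : ℝ) * ((inducedCopies H G).card : ℝ) ≤
      (n + 1) * (maxInducedDensity H n * (n.choose k : ℝ)) := by
    rw [← Nat.cast_mul, hcount, Nat.cast_sum]
    calc _ ≤ ∑ _v : Fin (n + 1), maxInducedDensity H n * (n.choose k : ℝ) := by
          refine Finset.sum_le_sum fun v _ => ?_
          have h1 := inducedDensity_le_max H (G.comap v.succAbove)
          rw [inducedDensity, Fintype.card_fin, ← hk, div_le_iff₀ hpos] at h1
          exact le_trans (by exact_mod_cast card_filter_inducedCopies_le H G v) h1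
      _ = _ := by simp
  have hch : ((n + 1 : ℕ) : ℝ) * (n.choose k : ℝ)
      = ((n + 1).choose k : ℝ) * ((n + 1 - k : ℕ) : ℝ) := by
    have h := Nat.choose_mul_succ_eq n k
    rw [mul_comm] at h
    exact_mod_cast h
  have hnk : (0 : ℝ) < ((n + 1 - k : ℕ) : ℝ) := by
    exact_mod_cast Nat.sub_pos_of_lt (Nat.lt_succ_of_le hn)
  rw [inducedDensity, Fintype.card_fin, ← hk, div_le_iff₀ hpos']
  refine le_of_mul_le_mul_left ?_ hnk
  push_cast at hch
  calc _ ≤ _ := hle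
    _ = maxInducedDensity H n * ((n + 1) * (n.choose k : ℝ)) := by ring
    _ = _ := by rw [hch]; ring

/-- The limit in the definition of the inducibility exists. -/
theorem tendsto_maxInducedDensity {V : Type*} [Fintype V] (H : SimpleGraph V) :
    Tendsto (maxInducedDensity H) atTop (𝓝 (inducibility H)) := by
  refine tendsto_nhds_limUnder ?_
  have hanti : Antitone fun n => maxInducedDensity H (n + Fintype.card V) :=
    antitone_nat_of_succ_le fun n => by
      have h := maxInducedDensity_succ_le H (n := n + Fintype.card V) (Nat.le_add_left _ _)
      rwa [Nat.add_right_comm] at h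
  have hbdd : BddBelow (Set.range fun n => maxInducedDensity H (n + Fintype.card V)) :=
    ⟨0, by rintro _ ⟨n, rfl⟩; exact maxInducedDensity_nonneg H _⟩
  exact ⟨_, (tendsto_add_atTop_iff_nat (Fintype.card V)).1 (tendsto_atTop_ciInf hanti hbdd)⟩

end

end GraphInducibility

/-!
Write `m` for the number of non-isolated vertices of `H`. Sampling `k` vertices with replacement
changes the induced density by a factor that tends to `1` as `n → ∞`, so it suffices to bound, for
every graph `G`, the probability `copyProb H G` that a uniformly random sequence of `k` vertices
of `G` induces a copy of `H`, equal vertices being treated as non-adjacent twins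
(`inducibility_le_of_forall_copyProb_le`). Such a sequence is exchangeable, so the non-isolated
vertices of a copy occupy uniformly random positions. There are two regimes.

*Few non-isolated vertices* (`m` bounded, `k / m` large). Reveal the sequence one vertex at a time,
and call a vertex an arrival if it is adjacent to an earlier one. The number of edges grows exactly
at arrivals. Let `y` be the probability that the whole sequence spans no edge. An induction over
the sequence, with the part seen so far as a parameter, bounds the probability of reaching a given
number of edges by `valueBound J y`, a concave function with maximum `1 / e` that is `-y log y` for
`y ≥ 1 / e`; here `J` bounds the number of arrivals still possible (`prob_completes_le`). The step
compares with the tangent at `y`, and its value at `0` absorbs the case that the next vertex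
is an arrival. For this the quiet probability must hardly change when a vertex is dropped, which
holds by exchangeability while at least `R` vertices are left (`quietProb_le_succ_add`); the
isolated vertices of a copy provide such a buffer at the end, as the last `R` positions rarely
contain a non-isolated vertex. To get strictly below `1 / e`, note that the bound has a gap unless
`y` is close to `1 / e` or larger. If `y` is that large, a first arrival that does not yet complete
a copy is too unlikely (`prob_completes_two_arrivals_le`), while at least half of the copies need
two arrivals: reversing the order of a copy with at least two edges and a single arrival produces
several arrivals (`two_mul_prob_isCopy_and_atMostOneArrival_le`). Both parts combine in
`exists_copyProb_le_of_numNonIsolated_le`.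

*Many non-isolated vertices* (`m ≥ 100000`, `k ≥ 4000 m`). Take a window of about `20 k / m`
positions. By Chebyshev's inequality (`sq_mul_prob_deviation_le`) it usually contains between `2`
and `40` non-isolated vertices of a copy, and usually each of them has a neighbour outside the
window (`prob_exists_neighbors_subset_le`). Fix the vertices outside the window, and let `A` be
the set of vertices of `G` with a neighbour among them. The number of vertices of the window in
`A` is binomial, and independent of the sequence of these vertices. The number of edges strictly
increases along this sequence, so it is right for at most one length `j`, and a binomial
distribution with many trials gives a small `j ≥ 2` probability at most about `2 / e ^ 2`
(`prob_window_le`). This yields `copyProb H G ≤ 0.3` (`copyProb_le_of_le_numNonIsolated`).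
-/

namespace GraphInducibility

open scoped BigOperators

/-! ### Uniform probabilities on finite types -/

open Classical in
/-- The probability of the event `p` under the uniform distribution on the finite type `Ω`. -/
noncomputable def prob {Ω : Type*} [Fintype Ω] (p : Ω → Prop) : ℝ :=
  𝔼 ω, if p ω then 1 else 0

section Prob

variable {Ω Ω' V : Type*} [Fintype Ω] [Fintype Ω'] [Fintype V]

theorem expect_mono {f g : Ω → ℝ} (h : ∀ ω, f ω ≤ g ω) : 𝔼 ω, f ω ≤ 𝔼 ω, g ω :=
  Finset.expect_le_expect fun ω _ => h ω

theorem prob_eq_expect (p : Ω → Prop) [DecidablePred p] :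
    prob p = 𝔼 ω, if p ω then 1 else 0 :=
  Finset.expect_congr rfl fun ω _ => by congr

theorem prob_mono {p q : Ω → Prop} (h : ∀ ω, p ω → q ω) : prob p ≤ prob q := by
  refine expect_mono fun ω => ?_
  by_cases hp : p ω
  · simp [hp, h ω hp]
  · by_cases hq : q ω <;> simp [hp, hq]

theorem prob_congr {p q : Ω → Prop} (h : ∀ ω, p ω ↔ q ω) : prob p = prob q :=
  le_antisymm (prob_mono fun ω => (h ω).1) (prob_mono fun ω => (h ω).2)

theorem prob_nonneg (p : Ω → Prop) : 0 ≤ prob p :=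
  Finset.expect_nonneg fun ω _ => by split_ifs <;> norm_num

theorem prob_le_one [Nonempty Ω] (p : Ω → Prop) : prob p ≤ 1 :=
  Finset.expect_le Finset.univ_nonempty fun ω _ => by split_ifs <;> norm_num

theorem prob_false {p : Ω → Prop} (h : ∀ ω, ¬ p ω) : prob p = 0 :=
  Finset.expect_eq_zero fun ω _ => if_neg (h ω)

theorem prob_true [Nonempty Ω] {p : Ω → Prop} (h : ∀ ω, p ω) : prob p = 1 := by
  simp [prob, h]

theorem prob_equiv (e : Ω ≃ Ω') (p : Ω' → Prop) : prob (fun ω => p (e ω)) = prob p :=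
  Fintype.expect_equiv e _ _ fun _ => rfl

theorem prob_le_sum {ι : Type*} {s : Finset ι} {p : Ω → Prop} {q : ι → Ω → Prop}
    (h : ∀ ω, p ω → ∃ i ∈ s, q i ω) : prob p ≤ ∑ i ∈ s, prob (q i) := by
  classical
  simp_rw [prob_eq_expect]
  rw [← Finset.expect_sum_comm]
  refine expect_mono fun ω => ?_
  have hnonneg : ∀ i ∈ s, (0 : ℝ) ≤ if q i ω then 1 else 0 := fun i _ => by
    split_ifs <;> norm_num
  split_ifs with hp
  · obtain ⟨i, hi, hq⟩ := h ω hp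
    exact (if_pos hq).ge.trans (Finset.single_le_sum hnonneg hi)
  · exact Finset.sum_nonneg hnonneg

theorem prob_add_of_disjoint {p q : Ω → Prop} (h : ∀ ω, p ω → ¬ q ω) :
    prob p + prob q = prob fun ω => p ω ∨ q ω := by
  unfold prob
  rw [← Finset.expect_add_distrib]
  refine Finset.expect_congr rfl fun ω _ => ?_
  by_cases hp : p ω
  · simp [hp, h ω hp]
  · by_cases hq : q ω <;> simp [hp, hq]

theorem prob_and_add_prob_and_not (p q : Ω → Prop) :
    prob (fun ω => p ω ∧ q ω) + prob (fun ω => p ω ∧ ¬ q ω) = prob p := by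
  rw [prob_add_of_disjoint fun ω h h' => h'.2 h.2]
  exact prob_congr fun ω => by tauto

theorem prob_sub_of_imp {p q : Ω → Prop} (h : ∀ ω, q ω → p ω) :
    prob (fun ω => p ω ∧ ¬ q ω) = prob p - prob q := by
  have h1 := prob_and_add_prob_and_not p q
  have h2 : prob (fun ω => p ω ∧ q ω) = prob q := prob_congr fun ω => by
    have := h ω; tauto
  linarith

theorem expect_fin_cons {r : ℕ} (F : (Fin (r + 1) → V) → ℝ) :
    𝔼 v, F v = 𝔼 u, 𝔼 v : Fin r → V, F (Fin.cons u v) := by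
  rw [← Finset.expect_product' (f := fun u (v : Fin r → V) => F (Fin.cons u v)),
    Finset.univ_product_univ]
  exact (Fintype.expect_equiv (Fin.consEquiv fun _ => V) _ _ fun _ => rfl).symm

theorem prob_fin_cons {r : ℕ} (p : (Fin (r + 1) → V) → Prop) :
    prob p = 𝔼 u, prob fun v : Fin r → V => p (Fin.cons u v) :=
  expect_fin_cons _

theorem prob_fin_append {s r : ℕ} (p : (Fin (s + r) → V) → Prop) :
    prob p = 𝔼 z : Fin s → V, prob fun w : Fin r → V => p (Fin.append z w) := by
  classical
  unfold prob
  rw [← Finset.expect_product'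
    (f := fun z w => if p (Fin.append z w) then (1 : ℝ) else 0), Finset.univ_product_univ]
  exact (Fintype.expect_equiv (Fin.appendEquiv s r) _ _ fun _ => rfl).symm

/-- A uniformly random sequence is exchangeable. -/
theorem prob_comp_perm {k : ℕ} (σ : Equiv.Perm (Fin k)) (p : (Fin k → V) → Prop) :
    prob (fun v : Fin k → V => p (v ∘ σ)) = prob p :=
  prob_equiv (σ.symm.arrowCongr (Equiv.refl V)) p

end Prob

/-! ### Edges inside a growing list of vertices -/

section Lists

variable {V : Type*} (G : SimpleGraph V)

/-- `u` has no neighbour in the list `Z`. -/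
def IsoTo (u : V) (Z : List V) : Prop := ∀ z ∈ Z, ¬ G.Adj u z

open Classical in
/-- The number of ordered pairs of adjacent entries of a list; repeated vertices count as
non-adjacent twins. -/
noncomputable def adjPairs (l : List V) : ℕ :=
  (l.map fun a => l.countP fun b => G.Adj a b).sum

variable {G}

theorem adjPairs_perm {l l' : List V} (h : l.Perm l') : adjPairs G l = adjPairs G l' := by
  unfold adjPairs
  rw [(h.map _).sum_eq]
  congr 1
  exact List.map_congr_left fun a _ => h.countP_eq _

open Classical in
theorem adjPairs_cons (u : V) (l : List V) :
    adjPairs G (u :: l) = adjPairs G l + 2 * l.countP fun b => G.Adj u b := by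
  have key : ∀ m : List V, (m.map fun a => (u :: l).countP fun b => G.Adj a b).sum =
      (m.map fun a => l.countP fun b => G.Adj a b).sum + m.countP fun b => G.Adj u b := by
    intro m
    induction m with
    | nil => simp
    | cons a m ih =>
      rw [List.map_cons, List.sum_cons, ih, List.map_cons, List.sum_cons,
        List.countP_cons (l := l), List.countP_cons (l := m), G.adj_comm a u]
      omega
  have h2 := key l
  unfold adjPairs
  rw [List.map_cons, List.sum_cons, h2, List.countP_cons]
  simp
  omega

theorem adjPairs_cons_of_isoTo {u : V} {l : List V} (h : IsoTo G u l) :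
    adjPairs G (u :: l) = adjPairs G l := by
  classical
  rw [adjPairs_cons, List.countP_eq_zero.2 fun b hb => by simpa using h b hb, mul_zero, add_zero]

theorem adjPairs_lt_cons {u : V} {l : List V} (h : ¬ IsoTo G u l) :
    adjPairs G l < adjPairs G (u :: l) := by
  classical
  have : 0 < l.countP fun b => G.Adj u b := by
    rw [List.countP_pos_iff]
    simpa [IsoTo] using h
  rw [adjPairs_cons]
  omega

theorem adjPairs_le_cons (u : V) (l : List V) : adjPairs G l ≤ adjPairs G (u :: l) := by
  by_cases h : IsoTo G u l
  · exact (adjPairs_cons_of_isoTo h).ge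
  · exact (adjPairs_lt_cons h).le

variable (G)

/-- The number of ordered adjacent pairs in the list `Z` extended by the vertices `v i`. -/
noncomputable def total (Z : List V) {r : ℕ} (v : Fin r → V) : ℕ :=
  adjPairs G (List.ofFn v ++ Z)

/-- When the vertices `v 0, v 1, …` are added to the list `Z` one by one, the vertex `v i` is an
*arrival* if it has a neighbour among the vertices added before it or in `Z`. -/
def Arrival (Z : List V) {r : ℕ} (v : Fin r → V) (i : Fin r) : Prop :=
  ¬ IsoTo G (v i) Z ∨ ∃ j < i, G.Adj (v j) (v i)

/-- Adding the vertices `v i` to the list `Z` creates no edges. -/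
def Quiet (Z : List V) {r : ℕ} (v : Fin r → V) : Prop :=
  (∀ i, IsoTo G (v i) Z) ∧ ∀ i j, ¬ G.Adj (v i) (v j)

variable {G} {Z : List V} {r : ℕ} {u : V} {v : Fin r → V}

theorem total_cons : total G Z (Fin.cons u v : Fin (r + 1) → V) = total G (u :: Z) v := by
  unfold total
  rw [List.ofFn_succ]
  simp only [Fin.cons_zero, Fin.cons_succ, List.cons_append]
  exact adjPairs_perm List.perm_middle.symm

theorem isoTo_cons_iff {z : V} : IsoTo G u (z :: Z) ↔ ¬ G.Adj u z ∧ IsoTo G u Z := by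
  simp [IsoTo]

theorem arrival_cons_zero :
    Arrival G Z (Fin.cons u v : Fin (r + 1) → V) 0 ↔ ¬ IsoTo G u Z := by
  simp [Arrival]

theorem arrival_cons_succ {i : Fin r} :
    Arrival G Z (Fin.cons u v : Fin (r + 1) → V) i.succ ↔ Arrival G (u :: Z) v i := by
  unfold Arrival
  rw [isoTo_cons_iff, Fin.cons_succ]
  constructor
  · rintro (h | ⟨j, hj, h⟩)
    · exact .inl fun h' => h h'.2
    · induction j using Fin.cases with
      | zero => exact .inl fun h' => h'.1 (by simpa using h.symm)
      | succ j => exact .inr ⟨j, by simpa using hj, by simpa using h⟩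
  · rintro (h | ⟨j, hj, h⟩)
    · by_cases h1 : G.Adj (v i) u
      · exact .inr ⟨0, Fin.succ_pos i, by simpa using h1.symm⟩
      · exact .inl fun h' => h ⟨h1, h'⟩
    · exact .inr ⟨j.succ, by simpa using hj, by simpa using h⟩

theorem quiet_cons :
    Quiet G Z (Fin.cons u v : Fin (r + 1) → V) ↔ IsoTo G u Z ∧ Quiet G (u :: Z) v := by
  simp only [Quiet, Fin.forall_fin_succ, Fin.cons_zero, Fin.cons_succ, isoTo_cons_iff,
    SimpleGraph.irrefl, not_false_eq_true, true_and, forall_and, G.adj_comm u]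
  tauto

theorem quiet_iff_forall_not_arrival : Quiet G Z v ↔ ∀ i, ¬ Arrival G Z v i := by
  constructor
  · rintro ⟨h1, h2⟩ i (h | ⟨j, -, h⟩)
    exacts [h (h1 i), h2 _ _ h]
  · intro h
    refine ⟨fun i => by_contra fun h' => h i (.inl h'), fun i j hij => ?_⟩
    rcases lt_trichotomy i j with hlt | rfl | hlt
    · exact h j (.inr ⟨i, hlt, hij⟩)
    · exact G.irrefl hij
    · exact h i (.inr ⟨j, hlt, hij.symm⟩)

theorem Quiet.mono {Z' : List V} (h : Quiet G Z' v) (hZ : Z ⊆ Z') : Quiet G Z v :=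
  ⟨fun i z hz => h.1 i z (hZ hz), h.2⟩

theorem adjPairs_le_total : adjPairs G Z ≤ total G Z v := by
  induction r generalizing Z with
  | zero => simp [total]
  | succ r ih =>
    induction v using Fin.consCases with
    | cons u v =>
      rw [total_cons]
      exact (adjPairs_le_cons u Z).trans ih

theorem total_eq_iff_quiet : total G Z v = adjPairs G Z ↔ Quiet G Z v := by
  induction r generalizing Z with
  | zero => simp [total, Quiet]
  | succ r ih =>
    induction v using Fin.consCases with
    | cons u v =>
      rw [total_cons, quiet_cons]
      by_cases h : IsoTo G u Z
      · rw [← adjPairs_cons_of_isoTo h, ih]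
        simp [h]
      · have h1 := adjPairs_lt_cons h
        have h2 := adjPairs_le_total (G := G) (Z := u :: Z) (v := v)
        simp only [h, false_and, iff_false]
        omega

end Lists

/-! ### The probability that no edge appears -/

section Quiet

variable {V : Type*} [Fintype V] (G : SimpleGraph V)

/-- The probability that `r` random vertices create no edges when added to the list `Z`. -/
noncomputable def quietProb (r : ℕ) (Z : List V) : ℝ :=
  prob fun v : Fin r → V => Quiet G Z v

open Classical in
theorem quietProb_succ (r : ℕ) (Z : List V) :
    quietProb G (r + 1) Z = 𝔼 u, if IsoTo G u Z then quietProb G r (u :: Z) else 0 := by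
  rw [quietProb, prob_fin_cons]
  refine Finset.expect_congr rfl fun u _ => ?_
  split_ifs with h
  · exact prob_congr fun v => by simp [quiet_cons, h]
  · exact prob_false fun v => by simp [quiet_cons, h]

theorem quietProb_anti (r : ℕ) {Z Z' : List V} (h : Z ⊆ Z') :
    quietProb G r Z' ≤ quietProb G r Z :=
  prob_mono fun _ hv => hv.mono h

theorem quietProb_nonneg (r : ℕ) (Z : List V) : 0 ≤ quietProb G r Z := prob_nonneg _

variable [Nonempty V]

theorem quietProb_le_one (r : ℕ) (Z : List V) : quietProb G r Z ≤ 1 := prob_le_one _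

theorem prob_succAbove {s : ℕ} (i : Fin (s + 1)) (p : (Fin s → V) → Prop) :
    prob (fun v : Fin (s + 1) → V => p fun j => v (i.succAbove j)) = prob p := by
  classical
  have h := prob_equiv (Fin.insertNthEquiv (fun _ => V) i)
    (fun v : Fin (s + 1) → V => p fun j => v (i.succAbove j))
  rw [← h]
  unfold prob
  rw [← Finset.univ_product_univ, Finset.expect_product]
  simp [Fin.insertNthEquiv]

/-- If deleting any one of three vertices destroyed all edges, no edge would have existed; hence
at most two vertices are responsible for the edges, and by exchangeability the last vertex is one
of them with probability at most `2 / (s + 1)`. -/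
theorem quietProb_le_succ_add (s : ℕ) (Z : List V) :
    quietProb G s Z ≤ quietProb G (s + 1) Z + 2 / (s + 1) := by
  classical
  let D : Fin (s + 1) → (Fin (s + 1) → V) → Prop := fun i v =>
    Quiet G Z (fun j => v (i.succAbove j)) ∧ ¬ Quiet G Z v
  have hD : ∀ i, prob (D i) = quietProb G s Z - quietProb G (s + 1) Z := by
    intro i
    rw [quietProb, quietProb, ← prob_succAbove i fun w : Fin s → V => Quiet G Z w]
    refine prob_sub_of_imp fun v hv => ⟨fun j => hv.1 _, fun j l => hv.2 _ _⟩
  have hquiet : ∀ (v : Fin (s + 1) → V) i, D i v →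
      (∀ a, a ≠ i → IsoTo G (v a) Z) ∧ ∀ a b, a ≠ i → b ≠ i → ¬ G.Adj (v a) (v b) := by
    intro v i hi
    refine ⟨fun a ha => ?_, fun a b ha hb => ?_⟩
    · obtain ⟨a, rfl⟩ := Fin.exists_succAbove_eq ha
      exact hi.1.1 a
    · obtain ⟨a, rfl⟩ := Fin.exists_succAbove_eq ha
      obtain ⟨b, rfl⟩ := Fin.exists_succAbove_eq hb
      exact hi.1.2 a b
  have hcard : ∀ v : Fin (s + 1) → V, (Finset.univ.filter fun i => D i v).card ≤ 2 := by
    intro v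
    by_contra! hlt
    obtain ⟨i, j, l, hi, hj, hl, hij, hil, hjl⟩ := Finset.two_lt_card_iff.1 hlt
    simp only [Finset.mem_filter, Finset.mem_univ, true_and] at hi hj hl
    refine hi.2 ⟨fun a => ?_, fun a b => ?_⟩
    · by_cases ha : a = i
      · exact (hquiet v j hj).1 a (ha ▸ hij)
      · exact (hquiet v i hi).1 a ha
    · by_cases h1 : a ≠ i ∧ b ≠ i
      · exact (hquiet v i hi).2 a b h1.1 h1.2
      by_cases h2 : a ≠ j ∧ b ≠ j
      · exact (hquiet v j hj).2 a b h2.1 h2.2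
      refine (hquiet v l hl).2 a b ?_ ?_ <;> grind
  have hsum : ∑ i, prob (D i) ≤ 2 := by
    unfold prob
    rw [← Finset.expect_sum_comm]
    refine Finset.expect_le Finset.univ_nonempty fun v _ => ?_
    calc _ = ((Finset.univ.filter fun i => D i v).card : ℝ) := by
          rw [Finset.card_filter]
          push_cast
          exact Finset.sum_congr rfl fun j _ => by congr
      _ ≤ 2 := by exact_mod_cast hcard v
  simp only [hD, Finset.sum_const, Finset.card_univ, Fintype.card_fin, nsmul_eq_mul] at hsum
  have hs : (0 : ℝ) < s + 1 := by positivity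
  push_cast at hsum
  rw [← sub_le_iff_le_add', le_div_iff₀ hs]
  linarith

end Quiet

/-! ### The bounding functions and their tangents -/

section ValueBound

/-- The convex function `x ↦ x ^ (n + 1)` lies above its tangent at `v`. -/
theorem mul_pow_le_add_pow (n : ℕ) {u v : ℝ} (hu : 0 ≤ u) (hv : 0 ≤ v) :
    (n + 1) * v ^ n * u ≤ n * v ^ (n + 1) + u ^ (n + 1) := by
  induction n with
  | zero => simp
  | succ n ih =>
    have h1 := mul_le_mul_of_nonneg_right ih hu
    have h2 : 0 ≤ (n + 1) * v ^ n * (u - v) ^ 2 := by positivity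
    push_cast
    linear_combination h1 + h2

theorem exp_one_mul_exp_neg_one : Real.exp 1 * Real.exp (-1) = 1 := by
  rw [← Real.exp_add]; simp

/-- The increasing concave function `1/e - (1 - e y)₊ ^ (J + 1) / (e (J + 1)!)`. -/
noncomputable def envelope (J : ℕ) (y : ℝ) : ℝ :=
  Real.exp (-1) * (1 - max 0 (1 - Real.exp 1 * y) ^ (J + 1) / (J + 1).factorial)

/-- The concave function that agrees with `envelope J` up to `1/e`, where it attains its maximum
`1/e`, and with `-y log y` from there on. -/
noncomputable def valueBound (J : ℕ) (y : ℝ) : ℝ :=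
  if y ≤ Real.exp (-1) then envelope J y else Real.negMulLog y

theorem envelope_le (J : ℕ) (y : ℝ) : envelope J y ≤ Real.exp (-1) := by
  have : 0 ≤ max 0 (1 - Real.exp 1 * y) ^ (J + 1) / ((J + 1).factorial : ℝ) := by positivity
  unfold envelope
  nlinarith [Real.exp_pos (-1)]

theorem envelope_of_ge {J : ℕ} {y : ℝ} (h : Real.exp (-1) ≤ y) :
    envelope J y = Real.exp (-1) := by
  have : 1 - Real.exp 1 * y ≤ 0 := by
    have := mul_le_mul_of_nonneg_left h (Real.exp_pos 1).le
    rw [exp_one_mul_exp_neg_one] at this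
    linarith
  simp [envelope, max_eq_left this]

theorem le_envelope {J : ℕ} {y : ℝ} (h0 : 0 ≤ y) (h : y ≤ Real.exp (-1)) : y ≤ envelope J y := by
  have h1 : Real.exp 1 * y ≤ 1 := by
    have := mul_le_mul_of_nonneg_left h (Real.exp_pos 1).le
    rwa [exp_one_mul_exp_neg_one] at this
  have h2 : 0 ≤ Real.exp 1 * y := by positivity
  unfold envelope
  rw [max_eq_right (by linarith)]
  set v := 1 - Real.exp 1 * y with hv
  have hv0 : 0 ≤ v := by linarith
  have h3 : v ^ (J + 1) / ((J + 1).factorial : ℝ) ≤ v := by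
    rw [div_le_iff₀ (by positivity)]
    calc v ^ (J + 1) ≤ v := pow_le_of_le_one hv0 (by linarith) (by simp)
      _ = v * 1 := by ring
      _ ≤ _ := by
        gcongr
        exact_mod_cast (J + 1).factorial_pos
  calc y = Real.exp (-1) * (1 - v) := by
        rw [hv]; linear_combination (-y) * exp_one_mul_exp_neg_one
    _ ≤ _ := by gcongr

theorem envelope_lipschitz {J : ℕ} {y w : ℝ} (h0 : 0 ≤ y) (hyw : y ≤ w) :
    envelope J w ≤ envelope J y + (w - y) := by
  unfold envelope
  have hmul : Real.exp 1 * y ≤ Real.exp 1 * w := by gcongr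
  have he := exp_one_mul_exp_neg_one
  set v := max 0 (1 - Real.exp 1 * y) with hv
  set u := max 0 (1 - Real.exp 1 * w) with hu
  have hu0 : 0 ≤ u := le_max_left _ _
  have huv : u ≤ v := max_le_max le_rfl (by linarith)
  have hv1 : v ≤ 1 := max_le zero_le_one (by have : 0 ≤ Real.exp 1 * y := by positivity
                                             linarith)
  have hdiff : v - u ≤ Real.exp 1 * (w - y) := by
    have h1 : 1 - Real.exp 1 * w ≤ u := le_max_right _ _
    have : v ≤ u + Real.exp 1 * (w - y) := max_le (by nlinarith) (by linarith)
    linarith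
  have hpow : v ^ (J + 1) - u ^ (J + 1) ≤ (J + 1) * (v - u) := by
    have h1 := mul_pow_le_add_pow J hu0 (hu0.trans huv)
    have h2 : (J + 1) * v ^ J * (v - u) ≤ (J + 1) * 1 * (v - u) := by
      gcongr
      exact pow_le_one₀ (hu0.trans huv) hv1
    have h3 : (J + 1) * v ^ J * v = (J + 1) * v ^ (J + 1) := by ring
    linarith
  have hfact : ((J : ℝ) + 1) ≤ (J + 1).factorial := by exact_mod_cast Nat.self_le_factorial _
  have hfpos : (0 : ℝ) < (J + 1).factorial := by positivity
  have hq : v ^ (J + 1) / (J + 1).factorial - u ^ (J + 1) / (J + 1).factorial ≤ v - u := by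
    rw [← sub_div, div_le_iff₀ hfpos]
    nlinarith
  have h4 : Real.exp (-1) * (v ^ (J + 1) / (J + 1).factorial - u ^ (J + 1) / (J + 1).factorial)
      ≤ Real.exp (-1) * (Real.exp 1 * (w - y)) := by
    gcongr
    exact hq.trans hdiff
  have h5 : Real.exp (-1) * (Real.exp 1 * (w - y)) = w - y := by
    linear_combination (w - y) * he
  linarith

theorem negMulLog_le_tangent {x y : ℝ} (hx : 0 ≤ x) (hy : 0 < y) :
    Real.negMulLog x ≤ y - (1 + Real.log y) * x := by
  rcases hx.eq_or_lt with rfl | hx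
  · simpa using hy.le
  · have h1 := Real.log_le_sub_one_of_pos (div_pos hy hx)
    rw [Real.log_div hy.ne' hx.ne'] at h1
    have h2 := mul_le_mul_of_nonneg_left h1 hx.le
    have h3 : x * (y / x - 1) = y - x := by field_simp
    rw [Real.negMulLog]
    linarith

theorem negMulLog_le_exp_neg_one {x : ℝ} (hx : 0 ≤ x) : Real.negMulLog x ≤ Real.exp (-1) := by
  simpa using negMulLog_le_tangent hx (Real.exp_pos (-1))

theorem valueBound_le_envelope (J : ℕ) (y : ℝ) : valueBound J y ≤ envelope J y := by
  unfold valueBound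
  split_ifs with h
  · exact le_rfl
  · push Not at h
    rw [envelope_of_ge h.le]
    exact negMulLog_le_exp_neg_one ((Real.exp_pos _).le.trans h.le)

theorem valueBound_le (J : ℕ) (y : ℝ) : valueBound J y ≤ Real.exp (-1) :=
  (valueBound_le_envelope J y).trans (envelope_le J y)

theorem valueBound_nonneg (J : ℕ) {y : ℝ} (h0 : 0 ≤ y) (h1 : y ≤ 1) : 0 ≤ valueBound J y := by
  unfold valueBound
  split_ifs with h
  · exact h0.trans (le_envelope h0 h)
  · exact Real.negMulLog_nonneg h0 h1

/-- The tangent `x ↦ α + β x` of `valueBound (J + 1)` at `y` lies above the graph, and its value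
`α` at `0` is at least `max y (envelope J y)`. The second property is a differential inequality:
the value after the next arrival is at most `α`. -/
theorem exists_tangent (J : ℕ) {y : ℝ} (h0 : 0 ≤ y) :
    ∃ α β : ℝ, (∀ x, 0 ≤ x → valueBound (J + 1) x ≤ α + β * x) ∧
      α + β * y = valueBound (J + 1) y ∧ y ≤ α ∧ envelope J y ≤ α := by
  have he := exp_one_mul_exp_neg_one
  have hpos := Real.exp_pos (-1)
  rcases le_or_gt y (Real.exp (-1)) with hy | hy
  · have h1 : Real.exp 1 * y ≤ 1 := by
      have := mul_le_mul_of_nonneg_left hy (Real.exp_pos 1).le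
      rwa [he] at this
    have h2 : 0 ≤ Real.exp 1 * y := by positivity
    have hval : valueBound (J + 1) y = envelope (J + 1) y := if_pos hy
    have hmax : max 0 (1 - Real.exp 1 * y) = 1 - Real.exp 1 * y := max_eq_right (by linarith)
    set v := 1 - Real.exp 1 * y with hv
    have hv0 : 0 ≤ v := by linarith
    have hf : ((J + 1 + 1).factorial : ℝ) = (J + 2) * (J + 1).factorial := by
      rw [Nat.factorial_succ]; push_cast; ring
    have hf0 : (0 : ℝ) < (J + 1).factorial := by positivity
    have hJ : (0 : ℝ) < J + 2 := by positivity
    set β := v ^ (J + 1) / (J + 1).factorial with hβ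
    have hvβ : v ^ (J + 1 + 1) / (J + 1 + 1).factorial = v * β / (J + 2) := by
      rw [hf, hβ]; field_simp; ring
    have hβ0 : 0 ≤ β := by positivity
    have hyv : y = Real.exp (-1) * (1 - v) := by
      rw [hv]; linear_combination (-y) * he
    have hα : envelope J y ≤ valueBound (J + 1) y - β * y := by
      rw [hval, envelope, envelope, hmax, hvβ, ← hβ]
      have h3 : v * β / (J + 2) + β * (1 - v) ≤ β := by
        have : v * β / (J + 2) ≤ v * β := by
          apply div_le_self (by positivity); linarith [(Nat.cast_nonneg J : (0:ℝ) ≤ J)]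
        linarith
      have h4 := mul_le_mul_of_nonneg_left h3 hpos.le
      have h5 : β * y = Real.exp (-1) * (β * (1 - v)) := by
        linear_combination β * hyv
      linarith
    refine ⟨valueBound (J + 1) y - β * y, β, fun x hx => ?_, by ring,
      (le_envelope h0 hy).trans hα, hα⟩
    refine (valueBound_le_envelope _ _).trans ?_
    rw [hval, envelope, envelope, hmax, hvβ]
    set u := max 0 (1 - Real.exp 1 * x) with hu
    have hu0 : 0 ≤ u := le_max_left _ _
    have hux : 1 - Real.exp 1 * x ≤ u := le_max_right _ _
    have h3 := mul_pow_le_add_pow (J + 1) hu0 hv0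
    have h4 : β * u ≤ (J + 1) / (J + 2) * (v * β) + u ^ (J + 1 + 1) / (J + 1 + 1).factorial := by
      rw [hf, hβ]
      push_cast at h3
      replace h3 := div_le_div_of_nonneg_right h3
        (by positivity : (0 : ℝ) ≤ (J + 2) * (J + 1).factorial)
      calc _ = ((J : ℝ) + 1 + 1) * v ^ (J + 1) * u / ((J + 2) * (J + 1).factorial) := by
            field_simp; ring
        _ ≤ _ := h3
        _ = _ := by field_simp; ring
    have h5 : (J + 1) / (J + 2) * (v * β) = v * β - v * β / (J + 2) := by field_simp; ring
    have h6 : β * (1 - Real.exp 1 * x) ≤ β * u := by gcongr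
    have h7 := mul_le_mul_of_nonneg_left (h6.trans h4) hpos.le
    have h8 : Real.exp (-1) * (β * (1 - Real.exp 1 * x)) = Real.exp (-1) * β - β * x := by
      linear_combination (-β * x) * he
    have h9 : β * y = Real.exp (-1) * (β * (1 - v)) := by
      linear_combination β * hyv
    rw [h8, h5] at h7
    linarith
  · have hy0 : 0 < y := hpos.trans hy
    have hlog : 0 ≤ 1 + Real.log y := by
      have := Real.log_le_log hpos hy.le
      rw [Real.log_exp] at this
      linarith
    have hval : valueBound (J + 1) y = Real.negMulLog y := if_neg hy.not_ge
    refine ⟨y, -(1 + Real.log y), fun x hx => ?_, ?_, le_rfl, ?_⟩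
    · rcases le_or_gt x (Real.exp (-1)) with hx1 | hx1
      · refine (valueBound_le _ _).trans ?_
        have h1 := negMulLog_le_tangent hpos.le hy0
        have h2 : Real.negMulLog (Real.exp (-1)) = Real.exp (-1) := by simp [Real.negMulLog]
        have h3 := mul_le_mul_of_nonneg_left hx1 hlog
        linarith
      · rw [valueBound, if_neg hx1.not_ge]
        have h1 := negMulLog_le_tangent hx hy0
        linarith
    · rw [hval, Real.negMulLog]; ring
    · exact (envelope_le _ _).trans hy.le

end ValueBound

/-! ### Completing a partial configuration -/

section Completion

variable {V : Type*} (G : SimpleGraph V)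

/-- The vertices `v i` complete the list `Z`, which does not have `t` ordered adjacent pairs, to
one that does, and none of the arrivals is among the last `R` vertices. -/
def Completes (t R r : ℕ) (Z : List V) (v : Fin (R + r) → V) : Prop :=
  total G Z v = t ∧ adjPairs G Z ≠ t ∧ ∀ i, r ≤ i.val → ¬ Arrival G Z v i

/-- At most one arrival occurs. -/
def AtMostOneArrival (Z : List V) {r : ℕ} (v : Fin r → V) : Prop :=
  ∀ i j, Arrival G Z v i → Arrival G Z v j → i = j

variable {G} {t R r : ℕ} {Z : List V} {u : V} {v : Fin (R + r) → V}

theorem not_completes_zero {v : Fin (R + 0) → V} : ¬ Completes G t R 0 Z v := by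
  rintro ⟨h1, h2, h3⟩
  have := quiet_iff_forall_not_arrival.2 fun i => h3 i (Nat.zero_le _)
  exact h2 ((total_eq_iff_quiet.2 this).symm.trans h1)

theorem Completes.of_cons_isoTo (hu : IsoTo G u Z)
    (h : Completes G t R (r + 1) Z (Fin.cons u v : Fin (R + r + 1) → V)) :
    Completes G t R r (u :: Z) v := by
  obtain ⟨h1, h2, h3⟩ := h
  refine ⟨total_cons ▸ h1, (adjPairs_cons_of_isoTo hu).symm ▸ h2, fun i hi h => ?_⟩
  exact h3 i.succ (by simpa using hi) (arrival_cons_succ.2 h)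

theorem Completes.of_cons_of_ne (hu : adjPairs G (u :: Z) ≠ t)
    (h : Completes G t R (r + 1) Z (Fin.cons u v : Fin (R + r + 1) → V)) :
    Completes G t R r (u :: Z) v := by
  obtain ⟨h1, h2, h3⟩ := h
  refine ⟨total_cons ▸ h1, hu, fun i hi h => ?_⟩
  exact h3 i.succ (by simpa using hi) (arrival_cons_succ.2 h)

theorem Completes.quiet_of_cons_of_eq (hu : adjPairs G (u :: Z) = t)
    (h : Completes G t R (r + 1) Z (Fin.cons u v : Fin (R + r + 1) → V)) :
    Quiet G (u :: Z) v :=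
  total_eq_iff_quiet.1 (by rw [← total_cons, h.1, hu])

theorem atMostOneArrival_cons_of_isoTo {v : Fin r → V} (hu : IsoTo G u Z) :
    AtMostOneArrival G Z (Fin.cons u v : Fin (r + 1) → V) ↔ AtMostOneArrival G (u :: Z) v := by
  simp [AtMostOneArrival, Fin.forall_fin_succ, arrival_cons_zero, arrival_cons_succ, hu]

theorem atMostOneArrival_cons_of_not_isoTo {v : Fin r → V} (hu : ¬ IsoTo G u Z) :
    AtMostOneArrival G Z (Fin.cons u v : Fin (r + 1) → V) ↔ Quiet G (u :: Z) v := by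
  rw [quiet_iff_forall_not_arrival]
  simp only [AtMostOneArrival, Fin.forall_fin_succ, arrival_cons_zero, arrival_cons_succ, hu]
  constructor
  · rintro ⟨⟨-, h⟩, -⟩ i hi
    exact absurd (h i (by simp) hi) (Fin.succ_ne_zero i).symm
  · intro h
    simp [h]

variable [Fintype V] [Nonempty V]

/-- The probability of completing a list is at most a concave function of the probability that
the list stays as it is: conditioning on the next vertex, one compares with the tangent of the
bounding function, whose value at `0` pays for an arrival. An arrival that completes the list has
to be followed by quiet, which is no more likely than quiet without it; any other arrival brings
the number of pairs closer to `t`, so `J` decreases. -/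
theorem prob_completes_le (J r : ℕ) (Z : List V) (hJ : t ≤ adjPairs G Z + J) :
    prob (Completes G t R r Z) ≤
      valueBound J (quietProb G (R + r) Z) + J * (2 / (R + 1)) := by
  classical
  induction r generalizing Z J with
  | zero =>
    rw [prob_false fun v => not_completes_zero]
    have := valueBound_nonneg J (quietProb_nonneg G (R + 0) Z) (quietProb_le_one G (R + 0) Z)
    positivity
  | succ r ih =>
    set Y := quietProb G (R + (r + 1)) Z with hY
    have hY0 : 0 ≤ Y := quietProb_nonneg G _ Z
    cases J with
    | zero =>
      rw [prob_false]
      · have := valueBound_nonneg 0 hY0 (quietProb_le_one G _ Z)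
        simpa using this
      · rintro v ⟨h1, h2, -⟩
        have := adjPairs_le_total (G := G) (Z := Z) (v := v)
        omega
    | succ J =>
      set ε : ℝ := 2 / (R + 1) with hε
      have hε0 : 0 ≤ ε := by positivity
      obtain ⟨α, β, hle, heq, hYα, hα⟩ := exists_tangent J hY0
      have hw : quietProb G (R + r) Z ≤ Y + ε := by
        refine (quietProb_le_succ_add G (R + r) Z).trans ?_
        have : (2 : ℝ) / ((R + r : ℕ) + 1) ≤ ε := by
          rw [hε]; push_cast; gcongr; linarith [(Nat.cast_nonneg r : (0 : ℝ) ≤ r)]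
        exact add_le_add le_rfl this
      have hwY : Y ≤ quietProb G (R + r) Z := by
        rw [hY, ← add_assoc, quietProb_succ G (R + r) Z]
        refine Finset.expect_le Finset.univ_nonempty fun u _ => ?_
        split_ifs
        · exact quietProb_anti G _ (List.subset_cons_self u Z)
        · exact quietProb_nonneg G _ Z
      have key : ∀ u, prob (fun v : Fin (R + r) → V =>
            Completes G t R (r + 1) Z (Fin.cons u v : Fin (R + r + 1) → V)) ≤
          (α + (J + 1) * ε) + β * (if IsoTo G u Z then quietProb G (R + r) (u :: Z) else 0) := by
        intro u
        have hqu := quietProb_anti G (R + r) (List.subset_cons_self u Z)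
        have hJε : 0 ≤ J * ε := by positivity
        split_ifs with hu
        · refine (prob_mono fun v hv => Completes.of_cons_isoTo hu hv).trans ?_
          refine (ih (J + 1) (u :: Z) (by rwa [adjPairs_cons_of_isoTo hu])).trans ?_
          have := hle _ (quietProb_nonneg G (R + r) (u :: Z))
          push_cast
          linarith
        · rw [mul_zero, add_zero]
          by_cases hc : adjPairs G (u :: Z) = t
          · refine (prob_mono fun v hv => Completes.quiet_of_cons_of_eq hc hv).trans ?_
            change quietProb G (R + r) (u :: Z) ≤ _
            linarith
          · refine (prob_mono fun v hv => Completes.of_cons_of_ne hc hv).trans ?_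
            refine (ih J (u :: Z) (by have := adjPairs_lt_cons hu; omega)).trans ?_
            have h1 := valueBound_le_envelope J (quietProb G (R + r) (u :: Z))
            have h2 := envelope_lipschitz (J := J) (quietProb_nonneg G (R + r) (u :: Z)) hqu
            have h3 := envelope_lipschitz (J := J) hY0 hwY
            have h4 : envelope J (quietProb G (R + r) (u :: Z)) ≤
                envelope J (quietProb G (R + r) Z) := by
              have hq := quietProb_nonneg G (R + r) (u :: Z)
              unfold envelope
              gcongr
            linarith
      calc prob (Completes G t R (r + 1) Z)
          = 𝔼 u, prob (fun v : Fin (R + r) → V =>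
            Completes G t R (r + 1) Z (Fin.cons u v : Fin (R + r + 1) → V)) := prob_fin_cons _
        _ ≤ 𝔼 u, ((α + (J + 1) * ε) +
            β * (if IsoTo G u Z then quietProb G (R + r) (u :: Z) else 0)) := expect_mono key
        _ = (α + (J + 1) * ε) + β * Y := by
            rw [Finset.expect_add_distrib, Fintype.expect_const, ← Finset.mul_expect,
              ← quietProb_succ G (R + r) Z]
            rfl
        _ = valueBound (J + 1) Y + (J + 1 : ℕ) * ε := by rw [← heq]; push_cast; ring

/-- If completing a list never has probability more than `c`, then a completion with at least two
arrivals requires a first arrival that does not complete the list, and then something of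
probability at most `c`. -/
theorem prob_completes_two_arrivals_le {c : ℝ} (hc0 : 0 ≤ c)
    (hc : ∀ r Z, prob (Completes G t R r Z) ≤ c) (r : ℕ) (Z : List V) :
    prob (fun v => Completes G t R r Z v ∧ ¬ AtMostOneArrival G Z v) +
      c * prob (fun v => Completes G t R r Z v ∧ AtMostOneArrival G Z v) ≤
      c * (1 - quietProb G (R + r) Z) := by
  classical
  induction r generalizing Z with
  | zero =>
    rw [prob_false fun v h => not_completes_zero h.1, prob_false fun v h => not_completes_zero h.1]
    have := quietProb_le_one G (R + 0) Z
    nlinarith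
  | succ r ih =>
    have key : ∀ u, prob (fun v : Fin (R + r) → V =>
          Completes G t R (r + 1) Z (Fin.cons u v : Fin (R + r + 1) → V) ∧
            ¬ AtMostOneArrival G Z (Fin.cons u v : Fin (R + r + 1) → V)) +
        c * prob (fun v : Fin (R + r) → V =>
          Completes G t R (r + 1) Z (Fin.cons u v : Fin (R + r + 1) → V) ∧
            AtMostOneArrival G Z (Fin.cons u v : Fin (R + r + 1) → V)) ≤
        c * (1 - if IsoTo G u Z then quietProb G (R + r) (u :: Z) else 0) := by
      intro u
      by_cases hu : IsoTo G u Z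
      · rw [if_pos hu]
        refine le_trans (add_le_add (prob_mono fun v hv => ?_)
          (mul_le_mul_of_nonneg_left (prob_mono fun v hv => ?_) hc0)) (ih (u :: Z))
        · exact ⟨hv.1.of_cons_isoTo hu, fun h => hv.2 ((atMostOneArrival_cons_of_isoTo hu).2 h)⟩
        · exact ⟨hv.1.of_cons_isoTo hu, (atMostOneArrival_cons_of_isoTo hu).1 hv.2⟩
      · rw [if_neg hu, sub_zero]
        by_cases ht : adjPairs G (u :: Z) = t
        · rw [prob_false, zero_add]
          · exact mul_le_mul_of_nonneg_left (prob_le_one _) hc0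
          · rintro v ⟨h1, h2⟩
            exact h2 ((atMostOneArrival_cons_of_not_isoTo hu).2 (h1.quiet_of_cons_of_eq ht))
        · rw [prob_false (p := fun v : Fin (R + r) → V => _ ∧ AtMostOneArrival G Z _), mul_zero,
            add_zero, mul_one]
          · exact (prob_mono fun v hv => hv.1.of_cons_of_ne ht).trans (hc r (u :: Z))
          · rintro v ⟨h1, h2⟩
            have := total_eq_iff_quiet.2 ((atMostOneArrival_cons_of_not_isoTo hu).1 h2)
            exact ht (by rw [← this, ← total_cons, h1.1])
    have h := expect_mono key
    rw [Finset.expect_add_distrib, ← Finset.mul_expect, ← Finset.mul_expect,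
      Finset.expect_sub_distrib, Fintype.expect_const, ← quietProb_succ G (R + r) Z] at h
    refine le_trans (le_of_eq ?_) h
    congr 1
    · exact prob_fin_cons _
    · congr 1
      exact prob_fin_cons _

end Completion

/-! ### Random sequences that induce a copy of a graph -/

section Copies

variable {V : Type*} {k : ℕ} (H : SimpleGraph (Fin k)) (G : SimpleGraph V)

/-- The sequence `v` of vertices of `G` induces a copy of `H`. Repetitions are allowed in `v`;
equal entries are regarded as non-adjacent twins. -/
def IsCopy (v : Fin k → V) : Prop := Nonempty (G.comap v ≃g H)

/-- The probability that a random sequence of vertices of `G` induces a copy of `H`. -/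
noncomputable def copyProb [Fintype V] : ℝ := prob (IsCopy H G)

variable {H G} {v : Fin k → V}

theorem isCopy_comp_perm (σ : Equiv.Perm (Fin k)) : IsCopy H G (v ∘ σ) ↔ IsCopy H G v := by
  let e : G.comap (v ∘ σ) ≃g G.comap v := ⟨σ, Iff.rfl⟩
  exact ⟨fun ⟨φ⟩ => ⟨e.symm.trans φ⟩, fun ⟨φ⟩ => ⟨e.trans φ⟩⟩

theorem not_isIsolated_comp_perm (σ : Equiv.Perm (Fin k)) (i : Fin k) :
    ¬ (G.comap (v ∘ σ)).IsIsolated i ↔ ¬ (G.comap v).IsIsolated (σ i) := by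
  simp only [SimpleGraph.IsIsolated, SimpleGraph.comap_adj, Function.comp_apply, not_iff_not]
  exact ⟨fun h w => by simpa using h (σ.symm w), fun h w => h (σ w)⟩

open Classical in
theorem IsCopy.card_not_isIsolated (h : IsCopy H G v) :
    (Finset.univ.filter fun i => ¬ (G.comap v).IsIsolated i).card = numNonIsolated H := by
  obtain ⟨φ⟩ := h
  have key : ∀ i, (G.comap v).IsIsolated i ↔ H.IsIsolated (φ i) := by
    intro i
    simp only [SimpleGraph.IsIsolated, ← φ.map_adj_iff]
    exact ⟨fun h w => by simpa using h (φ.symm w), fun h w => h (φ w)⟩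
  rw [numNonIsolated, ← Set.ncard_coe_finset]
  refine Set.ncard_congr (fun i _ => φ i) (fun i hi => ?_) (fun _ _ _ _ h => φ.injective h)
    fun j hj => ⟨φ.symm j, ?_, by simp⟩
  · simpa [key] using hi
  · simpa [key] using hj

theorem IsCopy.ncard_edgeSet (h : IsCopy H G v) :
    (G.comap v).edgeSet.ncard = H.edgeSet.ncard := by
  obtain ⟨φ⟩ := h
  exact Nat.card_congr φ.mapEdgeSet

theorem countP_ofFn {n : ℕ} (p : V → Prop) [DecidablePred p] (w : Fin n → V) :
    (List.ofFn w).countP (fun u => p u) = (Finset.univ.filter fun i => p (w i)).card := by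
  rw [List.ofFn_eq_map, List.countP_map, Finset.card_filter, ← List.sum_ofFn, List.ofFn_eq_map]
  induction List.finRange n with
  | nil => simp
  | cons a l ih => simp [List.countP_cons, ih, add_comm]

theorem adjPairs_ofFn (v : Fin k → V) :
    adjPairs G (List.ofFn v) = 2 * (G.comap v).edgeSet.ncard := by
  classical
  have h1 := (G.comap v).sum_degrees_eq_twice_card_edges
  rw [← SimpleGraph.coe_edgeFinset, Set.ncard_coe_finset, ← h1, adjPairs, List.map_ofFn,
    List.sum_ofFn]
  refine Finset.sum_congr rfl fun i _ => ?_
  have h2 : (G.comap v).neighborFinset i = Finset.univ.filter fun j => G.Adj (v i) (v j) := by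
    ext; simp
  rw [← SimpleGraph.card_neighborFinset_eq_degree, h2, ← countP_ofFn (fun b => G.Adj (v i) b) v]
  rfl

theorem IsCopy.total_nil (h : IsCopy H G v) : total G [] v = 2 * H.edgeSet.ncard := by
  rw [total, List.append_nil, adjPairs_ofFn, h.ncard_edgeSet]

/-- Both ends of an edge are non-isolated. -/
theorem ncard_edgeSet_le : H.edgeSet.ncard ≤ numNonIsolated H ^ 2 := by
  have hsub : H.edgeSet ⊆ (fun p : Fin k × Fin k => s(p.1, p.2)) ''
      ({v | ¬ H.IsIsolated v} ×ˢ {v | ¬ H.IsIsolated v}) := by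
    intro e he
    induction e with
    | _ a b =>
      have he : H.Adj a b := he
      exact ⟨(a, b), ⟨fun h => h b he, fun h => h a he.symm⟩, rfl⟩
  refine (Set.ncard_le_ncard hsub (Set.toFinite _)).trans
    ((Set.ncard_image_le (Set.toFinite _)).trans ?_)
  rw [Set.ncard_prod, numNonIsolated, sq]

theorem one_le_numNonIsolated (h : 2 ≤ H.edgeSet.ncard) : 1 ≤ numNonIsolated H := by
  have := ncard_edgeSet_le (H := H)
  by_contra! h0
  have : numNonIsolated H = 0 := by omega
  simp_all

end Copies

section Exchangeable

variable {V : Type*} [Fintype V] {k : ℕ}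

/-- An equivariant family of random variables indexed by positions has a constant mean. -/
theorem expect_position (ω : (Fin k → V) → Fin k → ℝ)
    (hω : ∀ v (σ : Equiv.Perm (Fin k)) i, ω (v ∘ σ) i = ω v (σ i)) (i : Fin k) :
    k * 𝔼 v, ω v i = 𝔼 v, ∑ j, ω v j := by
  have h : ∀ j, 𝔼 v, ω v j = 𝔼 v, ω v i := fun j =>
    Fintype.expect_equiv ((Equiv.swap i j).symm.arrowCongr (Equiv.refl V)) _ _ fun v => by
      rw [show (Equiv.arrowCongr (Equiv.swap i j).symm (Equiv.refl V)) v = v ∘ Equiv.swap i j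
        from rfl, hω, Equiv.swap_apply_left]
  rw [Finset.expect_sum_comm]
  simp [h]

/-- An equivariant family of random variables indexed by pairs of distinct positions has a
constant mean. -/
theorem expect_position_pair (ω : (Fin k → V) → Fin k → Fin k → ℝ)
    (hω : ∀ v (σ : Equiv.Perm (Fin k)) i j, ω (v ∘ σ) i j = ω v (σ i) (σ j)) {i j : Fin k}
    (hij : i ≠ j) :
    (k * (k - 1)) * 𝔼 v, ω v i j = 𝔼 v, ∑ p ∈ Finset.univ.offDiag, ω v p.1 p.2 := by
  have h : ∀ a b, a ≠ b → 𝔼 v, ω v a b = 𝔼 v, ω v i j := by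
    intro a b hab
    let σ := Equiv.swap (Equiv.swap i a j) b * Equiv.swap i a
    have h1 : a ≠ Equiv.swap i a j := fun h => hij <| by
      have := congrArg (Equiv.swap i a) h
      simpa using this
    have hi : σ i = a := by
      simp only [σ, Equiv.Perm.mul_apply, Equiv.swap_apply_left]
      exact Equiv.swap_apply_of_ne_of_ne h1 hab
    have hj : σ j = b := by simp [σ]
    refine Fintype.expect_equiv (σ.symm.arrowCongr (Equiv.refl V)) _ _ fun v => ?_
    rw [show (Equiv.arrowCongr σ.symm (Equiv.refl V)) v = v ∘ σ from rfl, hω, hi, hj]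
  rw [Finset.expect_sum_comm, Finset.sum_congr rfl fun p hp => h p.1 p.2 (by simpa using hp),
    Finset.sum_const, Finset.offDiag_card, Finset.card_univ, Fintype.card_fin, nsmul_eq_mul,
    Nat.cast_sub (Nat.le_mul_self k)]
  push_cast
  ring

variable {H : SimpleGraph (Fin k)} {G : SimpleGraph V}

/-- Each position is non-isolated in a proportion `m(H) / k` of the copies of `H`. -/
theorem mul_prob_isCopy_and_not_isIsolated (i : Fin k) :
    k * prob (fun v => IsCopy H G v ∧ ¬ (G.comap v).IsIsolated i) =
      numNonIsolated H * copyProb H G := by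
  classical
  rw [prob_eq_expect,
    expect_position (fun v i => if IsCopy H G v ∧ ¬ (G.comap v).IsIsolated i then 1 else 0)
    (fun v σ i => by simp only [isCopy_comp_perm, not_isIsolated_comp_perm]) i, copyProb,
    prob_eq_expect, Finset.mul_expect]
  refine Finset.expect_congr rfl fun v _ => ?_
  by_cases hv : IsCopy H G v
  · simp only [hv, true_and, if_true, mul_one, ← hv.card_not_isIsolated, Finset.sum_boole]
  · simp [hv]

end Exchangeable

/-! ### Few non-isolated vertices -/

section Small

variable {V : Type*} {k : ℕ} {H : SimpleGraph (Fin k)} {G : SimpleGraph V}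

/-- If a sequence has at most one arrival in either direction, then all its edges have the same
later and the same earlier endpoint. -/
theorem ncard_edgeSet_le_one_of_atMostOneArrival {v : Fin k → V}
    (h : AtMostOneArrival G [] v) (h' : AtMostOneArrival G [] (v ∘ Fin.revPerm)) :
    (G.comap v).edgeSet.ncard ≤ 1 := by
  have hlt : ∀ a b c d : Fin k, a < b → c < d → G.Adj (v a) (v b) → G.Adj (v c) (v d) →
      a = c ∧ b = d := by
    intro a b c d hab hcd h1 h2
    refine ⟨?_, h b d (.inr ⟨a, hab, h1⟩) (.inr ⟨c, hcd, h2⟩)⟩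
    have := h' a.rev c.rev (.inr ⟨b.rev, by simpa using hab, by simpa using h1.symm⟩)
      (.inr ⟨d.rev, by simpa using hcd, by simpa using h2.symm⟩)
    exact Fin.rev_injective this
  have hex : ∀ e ∈ (G.comap v).edgeSet, ∃ a b, a < b ∧ G.Adj (v a) (v b) ∧ e = s(a, b) := by
    intro e he
    induction e with
    | _ a b =>
      have he : G.Adj (v a) (v b) := he
      rcases lt_trichotomy a b with hab | rfl | hab
      · exact ⟨a, b, hab, he, rfl⟩
      · exact (G.irrefl he).elim
      · exact ⟨b, a, hab, he.symm, Sym2.eq_swap⟩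
  rw [Set.ncard_le_one (Set.toFinite _)]
  intro e he e' he'
  obtain ⟨a, b, hab, h1, rfl⟩ := hex e he
  obtain ⟨c, d, hcd, h2, rfl⟩ := hex e' he'
  obtain ⟨rfl, rfl⟩ := hlt a b c d hab hcd h1 h2
  rfl

variable [Fintype V]

/-- Reversing the order of a copy with a single arrival produces one with several arrivals. -/
theorem two_mul_prob_isCopy_and_atMostOneArrival_le (hH : 2 ≤ H.edgeSet.ncard) :
    2 * prob (fun v => IsCopy H G v ∧ AtMostOneArrival G [] v) ≤ copyProb H G := by
  have h := prob_comp_perm (V := V) Fin.revPerm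
    fun v : Fin k → V => IsCopy H G v ∧ AtMostOneArrival G [] v
  have hdisj : ∀ v : Fin k → V, (IsCopy H G v ∧ AtMostOneArrival G [] v) →
      ¬ (IsCopy H G (v ∘ Fin.revPerm) ∧ AtMostOneArrival G [] (v ∘ Fin.revPerm)) := by
    rintro v ⟨h1, h2⟩ ⟨-, h3⟩
    have := ncard_edgeSet_le_one_of_atMostOneArrival h2 h3
    rw [h1.ncard_edgeSet] at this
    omega
  have hsum := prob_add_of_disjoint hdisj
  rw [h] at hsum
  rw [two_mul, hsum]
  exact prob_mono fun v hv => hv.elim (·.1) fun h => (isCopy_comp_perm _).1 h.1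

/-- A copy rarely has non-isolated vertices among the last few positions. -/
theorem copyProb_le_prob_late_isolated_add {R r : ℕ} {H : SimpleGraph (Fin (R + r))} {ε : ℝ}
    (hpos : 0 < R + r) (hε : numNonIsolated H * (R : ℝ) ≤ ε * (R + r : ℕ)) :
    copyProb H G ≤ prob (fun v => IsCopy H G v ∧ ∀ i, r ≤ i.val → (G.comap v).IsIsolated i) +
      ε * copyProb H G := by
  classical
  have hf := prob_nonneg (IsCopy H G)
  have hpos' : (0 : ℝ) < (R + r : ℕ) := by exact_mod_cast hpos
  have hlate : (Finset.univ.filter fun i : Fin (R + r) => r ≤ i.val).card = R := by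
    have := Fin.card_filter_val_lt (n := R + r) (m := r)
    have h2 := Finset.card_filter_add_card_filter_not (s := (Finset.univ : Finset (Fin (R + r))))
      (fun i => i.val < r)
    simp only [not_lt, Finset.card_univ, Fintype.card_fin] at h2
    omega
  have hone : ∀ i, prob (fun v => IsCopy H G v ∧ ¬ (G.comap v).IsIsolated i) =
      numNonIsolated H * copyProb H G / (R + r : ℕ) := fun i => by
    rw [eq_div_iff hpos'.ne', mul_comm]
    exact mul_prob_isCopy_and_not_isIsolated i
  have hunion : prob (fun v => IsCopy H G v ∧
      ¬ ∀ i : Fin (R + r), r ≤ i.val → (G.comap v).IsIsolated i) ≤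
      ∑ i : Fin (R + r) with r ≤ i.val,
        prob (fun v => IsCopy H G v ∧ ¬ (G.comap v).IsIsolated i) := by
    refine prob_le_sum fun v ⟨h1, h2⟩ => ?_
    push Not at h2
    obtain ⟨i, hi, h2⟩ := h2
    exact ⟨i, Finset.mem_filter.2 ⟨Finset.mem_univ i, hi⟩, h1, h2⟩
  rw [Finset.sum_congr rfl fun i _ => hone i, Finset.sum_const, hlate, nsmul_eq_mul] at hunion
  have hsplit := prob_and_add_prob_and_not (IsCopy H G)
    fun v => ∀ i : Fin (R + r), r ≤ i.val → (G.comap v).IsIsolated i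
  have hbound : (R : ℝ) * (numNonIsolated H * copyProb H G / (R + r : ℕ)) ≤
      ε * copyProb H G := by
    rw [← mul_div_assoc, div_le_iff₀ hpos']
    have := mul_le_mul_of_nonneg_right hε hf
    unfold copyProb
    linarith
  change prob (IsCopy H G) ≤ _
  linarith

theorem exp_neg_one_gt : 0.3678 < Real.exp (-1) := by
  have h1 := exp_one_mul_exp_neg_one
  have h2 := Real.exp_one_lt_d9
  have h3 := Real.exp_pos (-1)
  nlinarith

theorem exp_neg_one_lt : Real.exp (-1) < 0.3679 := by
  have h1 := exp_one_mul_exp_neg_one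
  have h2 := Real.exp_one_gt_d9
  have h3 := Real.exp_pos (-1)
  nlinarith

/-- The gap between `valueBound J y` and `1/e` for `y` below `0.32 < 1/e`; here
`1 - 0.32 e ≥ 0.13`. -/
theorem valueBound_le_sub (J : ℕ) {y : ℝ} (hy : y ≤ 0.32) :
    valueBound J y ≤ Real.exp (-1) - Real.exp (-1) * (0.13 ^ (J + 1) / (J + 1).factorial) := by
  refine (valueBound_le_envelope J y).trans ?_
  have h1 : (0.13 : ℝ) ≤ max 0 (1 - Real.exp 1 * y) := by
    refine le_max_of_le_right ?_
    have := Real.exp_one_lt_d9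
    have := Real.exp_pos 1
    nlinarith
  have h2 : (0.13 : ℝ) ^ (J + 1) / (J + 1).factorial ≤
      max 0 (1 - Real.exp 1 * y) ^ (J + 1) / (J + 1).factorial := by gcongr
  have := mul_le_mul_of_nonneg_left h2 (Real.exp_pos (-1)).le
  unfold envelope
  linarith

/-- Let `y` be the probability that `k` random vertices span no edge. If `y` is small, the copy
probability is at most `1/e` minus the gap of the bounding function at `y`. If `y` is large, it is
rare that there is a first arrival that does not yet produce a copy; since half of the copies have
such an arrival, this loses a constant factor. -/
theorem exists_copyProb_le_of_numNonIsolated_le (M : ℕ) :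
    ∃ c K : ℝ, c < Real.exp (-1) ∧ 0 < K ∧ ∀ {V : Type} [Fintype V] [Nonempty V]
      (G : SimpleGraph V) (k : ℕ) (H : SimpleGraph (Fin k)), 2 ≤ H.edgeSet.ncard →
      numNonIsolated H ≤ M → K * numNonIsolated H ≤ k → copyProb H G ≤ c := by
  -- `J` bounds the number of ordered adjacent pairs in a copy; `2 M ^ 2` would do, and the
  -- summand `2` makes the gap `g` small without a case distinction.
  set J := 2 * M ^ 2 + 2 with hJ
  set g : ℝ := Real.exp (-1) * (0.13 ^ (J + 1) / (J + 1).factorial) with hg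
  have hg0 : 0 < g := by positivity
  have he1 := exp_neg_one_gt
  have he2 := exp_neg_one_lt
  have hg1 : g ≤ 0.001 := by
    have h1 : (0.13 : ℝ) ^ (J + 1) ≤ 0.13 ^ 3 :=
      pow_le_pow_of_le_one (by norm_num) (by norm_num) (by omega)
    have h2 : (0.13 : ℝ) ^ (J + 1) / (J + 1).factorial ≤ 0.13 ^ (J + 1) :=
      div_le_self (by positivity) (by exact_mod_cast (J + 1).factorial_pos)
    have h3 : (0.13 : ℝ) ^ (J + 1) / (J + 1).factorial ≤ 0.0022 := by
      refine (h2.trans h1).trans (by norm_num)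
    rw [hg]
    nlinarith
  -- The buffer `R` at the end of the sequence keeps the accumulated error below `g / 4`, and the
  -- constant `4 R / g` makes the last `R` positions isolated in all but a fraction `g / 4` of the
  -- copies.
  obtain ⟨R, hR⟩ := exists_nat_gt (8 * J / g)
  have hR0 : (0 : ℝ) < R := lt_of_le_of_lt (by positivity) hR
  have herr : J * (2 / ((R : ℝ) + 1)) ≤ g / 4 := by
    rw [div_lt_iff₀ hg0] at hR
    rw [← mul_div_assoc, div_le_iff₀ (by positivity)]
    nlinarith
  refine ⟨Real.exp (-1) - g / 4, 4 * R / g, by linarith, by positivity, ?_⟩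
  intro V _ _ G k H hH hM hk
  have hm : (1 : ℝ) ≤ numNonIsolated H := by exact_mod_cast one_le_numNonIsolated hH
  have hε : numNonIsolated H * (R : ℝ) ≤ g / 4 * k := by
    rw [div_mul_eq_mul_div, div_le_iff₀ hg0] at hk
    linarith
  have hRk : R ≤ k := by
    have : (R : ℝ) ≤ k := by nlinarith
    exact_mod_cast this
  obtain ⟨r, rfl⟩ := Nat.exists_eq_add_of_le hRk
  set t := 2 * H.edgeSet.ncard with ht
  have htJ : t ≤ J := by
    have h1 := ncard_edgeSet_le (H := H)
    have h2 : numNonIsolated H ^ 2 ≤ M ^ 2 := Nat.pow_le_pow_left hM 2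
    omega
  have hpos : 0 < R + r := Nat.add_pos_left (by exact_mod_cast hR0) r
  have htrim := copyProb_le_prob_late_isolated_add (G := G) hpos hε
  have hf0 : 0 ≤ copyProb H G := prob_nonneg _
  have hf1 : copyProb H G ≤ 1 := prob_le_one _
  set f := copyProb H G
  have hcompl : ∀ v, (IsCopy H G v ∧ ∀ i, r ≤ i.val → (G.comap v).IsIsolated i) →
      IsCopy H G v ∧ Completes G t R r [] v := by
    rintro v ⟨h1, h2⟩
    refine ⟨h1, h1.total_nil, by simp [adjPairs]; omega, fun i hi h => ?_⟩
    rcases h with h | ⟨j, -, h⟩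
    · exact h fun z hz => by simp at hz
    · exact h2 i hi j h.symm
  have hf : f - g / 4 * f ≤ prob fun v => IsCopy H G v ∧ Completes G t R r [] v := by
    have := prob_mono hcompl
    linarith
  -- This holds for every `r`, since only the buffer enters the error.
  have hc : ∀ r Z, prob (Completes G t R r Z) ≤ Real.exp (-1) + g / 4 := fun r Z =>
    (prob_completes_le J r Z (by omega)).trans (add_le_add (valueBound_le _ _) herr)
  set y := quietProb G (R + r) []
  -- For `y ≥ 0.32` the loss is enough: up to the small errors, `f (1 + 1/e) / 2 ≤ 0.68 / e`, which
  -- gives `f ≤ 0.366`, just below `1 / e ≈ 0.3679`.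
  rcases le_total y 0.32 with hy | hy
  · have h1 := prob_completes_le (G := G) (R := R) J r [] (t := t) (by omega)
    have h2 := valueBound_le_sub J hy
    have h3 : (prob fun v => IsCopy H G v ∧ Completes G t R r [] v) ≤
      prob (Completes G t R r []) := prob_mono fun v h => h.2
    rw [← hg] at h2
    nlinarith
  · set c := Real.exp (-1) + g / 4 with hcdef
    have h1 := prob_completes_two_arrivals_le (by positivity) hc r []
    have h2 := prob_and_add_prob_and_not
      (fun v => IsCopy H G v ∧ Completes G t R r [] v) (AtMostOneArrival G [])
    have h3 : prob (fun v => (IsCopy H G v ∧ Completes G t R r [] v) ∧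
        ¬ AtMostOneArrival G [] v) ≤
        prob (fun v => Completes G t R r [] v ∧ ¬ AtMostOneArrival G [] v) :=
      prob_mono fun v h => ⟨h.1.2, h.2⟩
    have h4 : prob (fun v => (IsCopy H G v ∧ Completes G t R r [] v) ∧
        AtMostOneArrival G [] v) ≤
        prob (fun v => Completes G t R r [] v ∧ AtMostOneArrival G [] v) :=
      prob_mono fun v h => ⟨h.1.2, h.2⟩
    have h5 : prob (fun v => (IsCopy H G v ∧ Completes G t R r [] v) ∧
        AtMostOneArrival G [] v) ≤
        prob (fun v => IsCopy H G v ∧ AtMostOneArrival G [] v) :=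
      prob_mono fun v h => ⟨h.1.1, h.2⟩
    have h6 := two_mul_prob_isCopy_and_atMostOneArrival_le (G := G) hH
    have hc0 : 0 < c := by positivity
    have hc1 : c ≤ 0.36815 := by linarith
    have h7 := mul_le_mul_of_nonneg_left h4 hc0.le
    have h8 : c * (1 - y) ≤ c * 0.68 := by gcongr; linarith
    set q := prob (fun v => (IsCopy H G v ∧ Completes G t R r [] v) ∧ AtMostOneArrival G [] v)
    have h9 : (1 - c) * q ≤ (1 - c) * (f / 2) := by
      gcongr
      · linarith
      · change _ ≤ copyProb H G / 2
        linarith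
    have h10 : f * ((1 + c) / 2) ≤ c * 0.68 + g / 4 * f := by nlinarith
    nlinarith

end Small

/-! ### A bound for binomial probabilities -/

section Binomial

/-- The function `μ ↦ μ ^ j * exp (-μ)` attains its maximum at `μ = j`. -/
theorem pow_mul_exp_neg_le (j : ℕ) {μ : ℝ} (hμ : 0 ≤ μ) :
    μ ^ j * Real.exp (-μ) ≤ (j : ℝ) ^ j * Real.exp (-j) := by
  rcases Nat.eq_zero_or_pos j with rfl | hj
  · simpa using hμ
  · have hj' : (0 : ℝ) < j := by exact_mod_cast hj
    have h1 : μ / j ≤ Real.exp (μ / j - 1) := by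
      have := Real.add_one_le_exp (μ / j - 1); linarith
    have h2 := pow_le_pow_left₀ (by positivity) h1 j
    rw [← Real.exp_nat_mul, div_pow, div_le_iff₀ (by positivity)] at h2
    have h3 : (j : ℝ) * (μ / j - 1) = μ + -j := by field_simp; ring
    rw [h3, Real.exp_add] at h2
    calc μ ^ j * Real.exp (-μ)
        ≤ Real.exp μ * Real.exp (-j) * (j : ℝ) ^ j * Real.exp (-μ) := by gcongr
      _ = (j : ℝ) ^ j * Real.exp (-j) * (Real.exp μ * Real.exp (-μ)) := by ring
      _ = _ := by rw [← Real.exp_add]; simp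

/-- The largest Poisson mass `j ^ j * exp (-j) / j!` of an atom `j` decreases in `j`,
and equals `2 * exp (-2)` at `j = 2`. -/
theorem pow_self_mul_exp_neg_le {j : ℕ} (hj : 2 ≤ j) :
    (j : ℝ) ^ j * Real.exp (-j) ≤ 2 * Real.exp (-2) * j.factorial := by
  induction j, hj using Nat.le_induction with
  | base => norm_num [Nat.factorial]; linarith
  | succ j hj ih =>
    have hj' : (0 : ℝ) < j := by exact_mod_cast (by omega : 0 < j)
    have h1 : ((j : ℝ) + 1) ^ j ≤ (j : ℝ) ^ j * Real.exp 1 := by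
      have h := pow_le_pow_left₀ (by positivity) (Real.add_one_le_exp (1 / (j : ℝ))) j
      rw [← Real.exp_nat_mul, mul_one_div_cancel hj'.ne'] at h
      calc ((j : ℝ) + 1) ^ j = (j : ℝ) ^ j * (1 / j + 1) ^ j := by
            rw [← mul_pow]; congr 1; field_simp; ring
        _ ≤ _ := by gcongr
    have h2 : Real.exp (-((j + 1 : ℕ) : ℝ)) = Real.exp (-j) * Real.exp (-1) := by
      rw [← Real.exp_add]; congr 1; push_cast; ring
    rw [h2, Nat.factorial_succ, pow_succ]
    push_cast
    calc ((j : ℝ) + 1) ^ j * (j + 1) * (Real.exp (-j) * Real.exp (-1))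
        ≤ (j : ℝ) ^ j * Real.exp 1 * (j + 1) * (Real.exp (-j) * Real.exp (-1)) := by gcongr
      _ = (j : ℝ) ^ j * Real.exp (-j) * (j + 1) := by
          linear_combination (j : ℝ) ^ j * Real.exp (-j) * (j + 1) * exp_one_mul_exp_neg_one
      _ ≤ 2 * Real.exp (-2) * j.factorial * (j + 1) := by gcongr
      _ = _ := by ring

/-- A binomial distribution with many trials gives an atom `j ≥ 2` that is not too large about the
mass that a Poisson distribution can give it, so not much more than `2 / e ^ 2`. -/
theorem choose_mul_pow_mul_pow_le {r j : ℕ} (hj : 2 ≤ j) (hjr : 50 * j ^ 2 ≤ r) {θ : ℝ}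
    (h0 : 0 ≤ θ) (h1 : θ ≤ 1) : r.choose j * (1 - θ) ^ (r - j) * θ ^ j ≤ 0.28 := by
  have hjr' : j ≤ r := by nlinarith
  have hj0 : (0 : ℝ) < j := by exact_mod_cast (by omega : 0 < j)
  have hr0 : (0 : ℝ) < r := by exact_mod_cast (by omega : 0 < r)
  have hjr2 : 50 * (j : ℝ) ^ 2 ≤ r := by exact_mod_cast hjr
  set μ := θ * (r - j) with hμ
  have hrj : (0 : ℝ) ≤ r - j := sub_nonneg.2 (by exact_mod_cast hjr')
  have hμ0 : 0 ≤ μ := by positivity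
  have hexp : (1 - θ) ^ (r - j) ≤ Real.exp (-μ) := by
    have := pow_le_pow_left₀ (by linarith) (Real.one_sub_le_exp_neg θ) (r - j)
    rw [← Real.exp_nat_mul, Nat.cast_sub hjr'] at this
    rwa [show ((r : ℝ) - j) * -θ = -μ by rw [hμ]; ring] at this
  have hchoose : (r.choose j : ℝ) ≤ r ^ j / j.factorial := Nat.choose_le_pow_div j r
  -- Replacing `r` by `r - j` in the Poisson parameter costs a factor at most `1 / 0.98`, and
  -- `0.28 * 0.98` still exceeds `2 / e ^ 2 ≈ 0.2707`.
  have hbern : (0.98 : ℝ) ≤ (1 - j / r) ^ j := by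
    have h2 : (-2 : ℝ) ≤ -(j / r) := by
      have : (j : ℝ) / r ≤ 1 := (div_le_one hr0).2 (by linarith)
      linarith
    have h3 := one_add_mul_le_pow h2 j
    have h4 : (j : ℝ) * (j / r) ≤ 0.02 := by
      rw [← mul_div_assoc, div_le_iff₀ hr0]; nlinarith
    calc (0.98 : ℝ) ≤ 1 + j * -(j / r) := by linarith
      _ ≤ _ := by rwa [sub_eq_add_neg]
  have hfact : (0 : ℝ) < j.factorial := by positivity
  have hmain : r.choose j * (1 - θ) ^ (r - j) * θ ^ j * (1 - j / r) ^ j ≤ 2 * Real.exp (-2) := by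
    calc r.choose j * (1 - θ) ^ (r - j) * θ ^ j * (1 - j / r) ^ j
        ≤ (r ^ j / j.factorial) * Real.exp (-μ) * θ ^ j * (1 - j / r) ^ j := by
          have : (0 : ℝ) ≤ (1 - j / r) ^ j := by linarith
          have : 0 ≤ 1 - θ := by linarith
          gcongr
      _ = (μ ^ j * Real.exp (-μ)) / j.factorial := by
          have : μ ^ j = r ^ j * θ ^ j * (1 - j / r) ^ j := by
            rw [← mul_pow, ← mul_pow, hμ]; congr 1; field_simp
          rw [this]; ring
      _ ≤ (2 * Real.exp (-2) * j.factorial) / j.factorial := by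
          exact div_le_div_of_nonneg_right
            ((pow_mul_exp_neg_le j hμ0).trans (pow_self_mul_exp_neg_le hj)) hfact.le
      _ = _ := by field_simp
  have he : Real.exp (-2) ≤ 0.1354 := by
    have h2 := exp_neg_one_lt
    have h3 : Real.exp (-2) = Real.exp (-1) * Real.exp (-1) := by
      rw [← Real.exp_add]; norm_num
    rw [h3]
    nlinarith [Real.exp_pos (-1)]
  have hpos : 0 ≤ r.choose j * (1 - θ) ^ (r - j) * θ ^ j := by
    have : 0 ≤ 1 - θ := by linarith
    positivity
  nlinarith

end Binomial

/-! ### Extending a list by vertices with neighbours in it -/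

section Window

variable {V : Type*} {G : SimpleGraph V}

/-- Deleting entries without neighbours does not change the number of adjacent pairs. -/
theorem adjPairs_filter_append (A : V → Prop) [DecidablePred A] {l S : List V}
    (h : ∀ u ∈ l, ¬ A u → IsoTo G u (l ++ S)) :
    adjPairs G (l.filter A ++ S) = adjPairs G (l ++ S) := by
  classical
  induction l with
  | nil => simp
  | cons a l ih =>
    have ih := ih fun u hu hA z hz => h u (List.mem_cons_of_mem a hu) hA z
      (List.mem_cons_of_mem a hz)
    by_cases ha : A a
    · rw [List.filter_cons_of_pos (by simpa using ha), List.cons_append, List.cons_append,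
        adjPairs_cons, adjPairs_cons, ih, List.countP_append, List.countP_append,
        List.countP_filter]
      congr 3
      refine List.countP_congr fun b hb => ?_
      simp only [Bool.and_eq_true, decide_eq_true_eq, and_iff_left_iff_imp]
      intro hab
      by_contra hA
      exact h b (List.mem_cons_of_mem a hb) hA a (by simp) hab.symm
    · have hiso : IsoTo G a (l ++ S) := fun z hz =>
        h a (by simp) ha z (List.mem_cons_of_mem a hz)
      rw [List.filter_cons_of_neg (by simpa using ha), ih, List.cons_append,
        adjPairs_cons_of_isoTo hiso]

variable [Fintype V] (G)

open Classical in
/-- The probability that `j` random vertices all satisfy `A` and extend `S` to a list with `t`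
ordered adjacent pairs. -/
noncomputable def hitProb (A : V → Prop) (t : ℕ) : ℕ → List V → ℝ
  | 0, S => if adjPairs G S = t then 1 else 0
  | j + 1, S => 𝔼 u, if A u then hitProb A t j (u :: S) else 0

variable {G} {A : V → Prop} {t : ℕ}

theorem hitProb_eq_zero_of_lt (j : ℕ) {S : List V} (h : t < adjPairs G S) :
    hitProb G A t j S = 0 := by
  induction j generalizing S with
  | zero => simp [hitProb, h.ne']
  | succ j ih =>
    refine Finset.expect_eq_zero fun u _ => ?_
    rw [ih (h.trans_le (adjPairs_le_cons u S)), ite_self]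

/-- If every vertex in `A` creates an edge, then along a random sequence of vertices in `A` the
value `t` is attained at most once. -/
theorem sum_hitProb_div_le_one {Z : List V} (hA : ∀ u, A u → ¬ IsoTo G u Z) (hθ : 0 < prob A)
    (n : ℕ) {S : List V} (hS : Z ⊆ S) :
    ∑ j ∈ Finset.range n, hitProb G A t j S / prob A ^ j ≤ 1 := by
  classical
  have hA' : ∀ u S, Z ⊆ S → A u → adjPairs G S < adjPairs G (u :: S) := fun u S hS hu =>
    adjPairs_lt_cons fun h => hA u hu fun z hz => h z (hS hz)
  induction n generalizing S with
  | zero => simp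
  | succ n ih =>
    rw [Finset.sum_range_succ']
    by_cases ht : adjPairs G S = t
    · rw [Finset.sum_eq_zero, zero_add]
      · simp [hitProb, ht]
      · intro j _
        rw [hitProb, Finset.expect_eq_zero, zero_div]
        intro u _
        split_ifs with hu
        · exact hitProb_eq_zero_of_lt j (ht ▸ hA' u S hS hu)
        · rfl
    · have h0 : hitProb G A t 0 S = 0 := by simp [hitProb, ht]
      rw [h0, zero_div, add_zero]
      have h1 : ∀ j, hitProb G A t (j + 1) S / prob A ^ (j + 1) =
          (𝔼 u, if A u then hitProb G A t j (u :: S) / prob A ^ j else 0) / prob A := by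
        intro j
        rw [hitProb, pow_succ, ← div_div, Finset.expect_div]
        congr 1
        refine Finset.expect_congr rfl fun u _ => ?_
        split_ifs <;> simp
      rw [Finset.sum_congr rfl fun j _ => h1 j, ← Finset.sum_div, div_le_one hθ,
        ← Finset.expect_sum_comm, prob_eq_expect]
      refine expect_mono fun u => ?_
      split_ifs
      · exact ih (List.subset_cons_of_subset u hS)
      · simp

variable [Nonempty V]

open Classical in
/-- The number of entries of a random sequence that satisfy `A` is binomial, and is independent
of the sequence of these entries. -/
theorem prob_countP_eq_and_adjPairs_filter_eq (r j : ℕ) (S : List V) :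
    prob (fun w : Fin r → V => (List.ofFn w).countP (fun u => A u) = j ∧
      adjPairs G ((List.ofFn w).filter (fun u => A u) ++ S) = t) =
      r.choose j * (1 - prob A) ^ (r - j) * hitProb G A t j S := by
  induction r generalizing j S with
  | zero =>
    cases j with
    | zero =>
      by_cases h : adjPairs G S = t
      · rw [prob_true fun w => by simp [h]]
        simp [hitProb, h]
      · rw [prob_false fun w => by simp [h]]
        simp [hitProb, h]
    | succ j =>
      rw [prob_false fun w => by simp]
      simp
  | succ r ih =>
    have hstep : ∀ (u : V) (w : Fin r → V) (j : ℕ),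
        ((List.ofFn (Fin.cons u w : Fin (r + 1) → V)).countP (fun u => A u) = j ∧
          adjPairs G ((List.ofFn (Fin.cons u w : Fin (r + 1) → V)).filter (fun u => A u) ++ S) = t)
        ↔ if A u then (List.ofFn w).countP (fun u => A u) + 1 = j ∧
            adjPairs G ((List.ofFn w).filter (fun u => A u) ++ u :: S) = t
          else (List.ofFn w).countP (fun u => A u) = j ∧
            adjPairs G ((List.ofFn w).filter (fun u => A u) ++ S) = t := by
      intro u w j
      simp only [List.ofFn_succ, Fin.cons_zero, Fin.cons_succ]
      split_ifs with hu
      · rw [List.countP_cons_of_pos (by simpa using hu),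
          List.filter_cons_of_pos (by simpa using hu), List.cons_append,
          adjPairs_perm (List.perm_middle (a := u)).symm]
      · rw [List.countP_cons_of_neg (by simpa using hu),
          List.filter_cons_of_neg (by simpa using hu)]
    have hnot : (𝔼 u, if A u then (0 : ℝ) else 1) = 1 - prob A := by
      rw [prob_eq_expect, ← Fintype.expect_const (ι := V) (1 : ℝ), ← Finset.expect_sub_distrib]
      refine Finset.expect_congr rfl fun u _ => ?_
      split_ifs <;> simp
    rw [prob_fin_cons]
    cases j with
    | zero =>
      have h : ∀ u, prob (fun w : Fin r → V =>
          (List.ofFn (Fin.cons u w : Fin (r + 1) → V)).countP (fun u => A u) = 0 ∧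
          adjPairs G ((List.ofFn (Fin.cons u w : Fin (r + 1) → V)).filter (fun u => A u) ++ S) = t)
          = (if A u then 0 else 1) *
            (r.choose 0 * (1 - prob A) ^ (r - 0) * hitProb G A t 0 S) := by
        intro u
        rw [← ih, prob_congr fun w => hstep u w 0]
        split_ifs with hu
        · rw [prob_false fun w => by simp, zero_mul]
        · rw [one_mul]
      rw [Finset.expect_congr rfl fun u _ => h u, ← Finset.expect_mul, hnot]
      simp [pow_succ]
      ring
    | succ j =>
      have h : ∀ u, prob (fun w : Fin r → V =>
          (List.ofFn (Fin.cons u w : Fin (r + 1) → V)).countP (fun u => A u) = j + 1 ∧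
          adjPairs G ((List.ofFn (Fin.cons u w : Fin (r + 1) → V)).filter (fun u => A u) ++ S) = t)
          = (r.choose j * (1 - prob A) ^ (r - j)) *
              (if A u then hitProb G A t j (u :: S) else 0) +
            (if A u then 0 else 1) *
            (r.choose (j + 1) * (1 - prob A) ^ (r - (j + 1)) * hitProb G A t (j + 1) S) := by
        intro u
        rw [← ih, prob_congr fun w => hstep u w (j + 1)]
        split_ifs with hu
        · rw [← ih, zero_mul, add_zero]
          exact prob_congr fun w => by simp
        · simp
      rw [Finset.expect_congr rfl fun u _ => h u, Finset.expect_add_distrib, ← Finset.expect_mul,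
        hnot, ← Finset.mul_expect]
      rw [show (𝔼 u, if A u then hitProb G A t j (u :: S) else 0) = hitProb G A t (j + 1) S
        from rfl, Nat.choose_succ_succ, Nat.add_sub_add_right]
      push_cast
      rcases lt_or_ge j r with hjr | hjr
      · rw [show r - j = r - (j + 1) + 1 by omega]
        ring
      · rw [Nat.choose_eq_zero_of_lt (by omega : r < j + 1)]
        push_cast
        ring

open Classical in
/-- Among random vertices, those in a set `A` of vertices with a neighbour in `Z` are binomial in
number. Since the number of ordered adjacent pairs increases with each of them, it equals `t` for
at most one value of that number. -/
theorem prob_window_le {r a : ℕ} (hr : 50 * a ^ 2 ≤ r) {Z : List V}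
    (hA : ∀ u, A u → ¬ IsoTo G u Z) :
    prob (fun w : Fin r → V =>
      (2 ≤ (List.ofFn w).countP (fun u => A u) ∧ (List.ofFn w).countP (fun u => A u) ≤ a) ∧
      adjPairs G ((List.ofFn w).filter (fun u => A u) ++ Z) = t) ≤ 0.28 := by
  have hθ1 : prob A ≤ 1 := prob_le_one A
  have hsum : prob (fun w : Fin r → V =>
      (2 ≤ (List.ofFn w).countP (fun u => A u) ∧ (List.ofFn w).countP (fun u => A u) ≤ a) ∧
      adjPairs G ((List.ofFn w).filter (fun u => A u) ++ Z) = t) ≤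
      ∑ j ∈ Finset.Icc 2 a, prob (fun w : Fin r → V =>
        (List.ofFn w).countP (fun u => A u) = j ∧
        adjPairs G ((List.ofFn w).filter (fun u => A u) ++ Z) = t) :=
    prob_le_sum fun w h => ⟨_, Finset.mem_Icc.2 h.1, rfl, h.2⟩
  refine hsum.trans ?_
  have hhit : ∀ j S, 0 ≤ hitProb G A t j S := by
    intro j
    induction j with
    | zero => intro S; unfold hitProb; split_ifs <;> norm_num
    | succ j ih =>
      intro S
      exact Finset.expect_nonneg fun u _ => by split_ifs; exacts [ih _, le_rfl]
  rcases (prob_nonneg A).eq_or_lt with h0 | h0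
  · have hzero : ∀ j ∈ Finset.Icc 2 a, prob (fun w : Fin r → V =>
        (List.ofFn w).countP (fun u => A u) = j ∧
        adjPairs G ((List.ofFn w).filter (fun u => A u) ++ Z) = t) = 0 := by
      intro j hj
      rw [prob_countP_eq_and_adjPairs_filter_eq]
      obtain ⟨j, rfl⟩ : ∃ i, j = i + 1 := ⟨j - 1, by have := (Finset.mem_Icc.1 hj).1; omega⟩
      have hno : ∀ u, ¬ A u := by
        intro u hu
        have : 0 < prob A := by
          rw [prob_eq_expect]
          refine Finset.expect_pos' (fun v _ => by split_ifs <;> norm_num)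
            ⟨u, Finset.mem_univ u, by simp [hu]⟩
        linarith
      have : hitProb G A t (j + 1) Z = 0 :=
        Finset.expect_eq_zero fun u _ => if_neg (hno u)
      rw [this, mul_zero]
    rw [Finset.sum_eq_zero hzero]
    norm_num
  · calc ∑ j ∈ Finset.Icc 2 a, prob (fun w : Fin r → V =>
          (List.ofFn w).countP (fun u => A u) = j ∧
          adjPairs G ((List.ofFn w).filter (fun u => A u) ++ Z) = t)
        ≤ ∑ j ∈ Finset.Icc 2 a, 0.28 * (hitProb G A t j Z / prob A ^ j) := by
          refine Finset.sum_le_sum fun j hj => ?_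
          rw [Finset.mem_Icc] at hj
          rw [prob_countP_eq_and_adjPairs_filter_eq]
          have hjr : 50 * j ^ 2 ≤ r := by
            have := Nat.pow_le_pow_left hj.2 2
            omega
          have h1 := choose_mul_pow_mul_pow_le hj.1 hjr h0.le hθ1
          have h2 : 0 ≤ hitProb G A t j Z / prob A ^ j := by
            have := hhit j Z
            positivity
          have h3 : r.choose j * (1 - prob A) ^ (r - j) * hitProb G A t j Z =
            r.choose j * (1 - prob A) ^ (r - j) * prob A ^ j *
              (hitProb G A t j Z / prob A ^ j) := by field_simp
          rw [h3]
          gcongr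
      _ = 0.28 * ∑ j ∈ Finset.Icc 2 a, hitProb G A t j Z / prob A ^ j := by
          rw [Finset.mul_sum]
      _ ≤ 0.28 * ∑ j ∈ Finset.range (a + 1), hitProb G A t j Z / prob A ^ j := by
          refine mul_le_mul_of_nonneg_left ?_ (by norm_num)
          refine Finset.sum_le_sum_of_subset_of_nonneg (fun j hj => ?_) fun j _ _ => ?_
          · rw [Finset.mem_Icc] at hj
            exact Finset.mem_range.2 (by omega)
          · have := hhit j Z
            positivity
      _ ≤ 0.28 * 1 := by
          gcongr
          exact sum_hitProb_div_le_one hA h0 _ (List.Subset.refl Z)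
      _ = 0.28 := mul_one _

end Window

/-! ### Many non-isolated vertices -/

section Large

variable {V : Type*} [Fintype V] {k : ℕ}

theorem expect_sum_offDiag (ω : (Fin k → V) → Fin k → Fin k → ℝ)
    (hω : ∀ v (σ : Equiv.Perm (Fin k)) i j, ω (v ∘ σ) i j = ω v (σ i) (σ j))
    (Δ : Finset (Fin k)) :
    (k * (k - 1)) * 𝔼 v, ∑ p ∈ Δ.offDiag, ω v p.1 p.2 =
      (Δ.card * (Δ.card - 1)) * 𝔼 v, ∑ p ∈ Finset.univ.offDiag, ω v p.1 p.2 := by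
  rw [Finset.expect_sum_comm, Finset.mul_sum,
    Finset.sum_congr rfl fun p hp => expect_position_pair ω hω (Finset.mem_offDiag.1 hp).2.2,
    Finset.sum_const, Finset.offDiag_card, nsmul_eq_mul, Nat.cast_sub (Nat.le_mul_self _)]
  push_cast
  ring

variable {H : SimpleGraph (Fin k)} {G : SimpleGraph V}

open Classical in
/-- Chebyshev's inequality for the number of non-isolated vertices that a random copy of `H` has
in a fixed set of positions. -/
theorem sq_mul_prob_deviation_le (hk : 2 ≤ k) (Δ : Finset (Fin k)) {μ d : ℝ}
    (hμ : μ * k = Δ.card * numNonIsolated H) (hd : 0 ≤ d) :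
    d ^ 2 * prob (fun v => IsCopy H G v ∧
      d ≤ |((Δ.filter fun i => ¬ (G.comap v).IsIsolated i).card : ℝ) - μ|) ≤
      μ * copyProb H G := by
  have hk0 : (0 : ℝ) < k := by exact_mod_cast (by omega : 0 < k)
  have hk1 : (0 : ℝ) < (k : ℝ) - 1 := by
    have : (2 : ℝ) ≤ k := by exact_mod_cast hk
    linarith
  set m : ℝ := (numNonIsolated H : ℝ) with hm
  set f := copyProb H G with hf
  have hf0 : 0 ≤ f := prob_nonneg _
  have hm0 : 0 ≤ m := by positivity
  set X : (Fin k → V) → ℝ := fun v => ((Δ.filter fun i => ¬ (G.comap v).IsIsolated i).card : ℝ)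
    with hX
  have hfE : f = 𝔼 v : Fin k → V, if IsCopy H G v then 1 else 0 := rfl
  have hE1 : (𝔼 v, if IsCopy H G v then X v else 0) = μ * f := by
    have h1 : (𝔼 v, if IsCopy H G v then X v else 0) =
        ∑ i ∈ Δ, prob fun v => IsCopy H G v ∧ ¬ (G.comap v).IsIsolated i := by
      simp_rw [prob_eq_expect]
      rw [← Finset.expect_sum_comm]
      refine Finset.expect_congr rfl fun v _ => ?_
      by_cases hv : IsCopy H G v
      · simp only [hv, true_and, if_true, hX, Finset.sum_boole]
      · simp [hv]
    have h2 : (k : ℝ) * (𝔼 v, if IsCopy H G v then X v else 0) = k * (μ * f) := by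
      rw [h1, Finset.mul_sum,
        Finset.sum_congr rfl fun i _ => mul_prob_isCopy_and_not_isIsolated i, Finset.sum_const,
        nsmul_eq_mul]
      linear_combination (-f) * hμ
    exact mul_left_cancel₀ hk0.ne' h2
  have hoff : ∀ (S : Finset (Fin k)) (v : Fin k → V),
      ∑ p ∈ S.offDiag, (if IsCopy H G v ∧ ¬ (G.comap v).IsIsolated p.1 ∧
        ¬ (G.comap v).IsIsolated p.2 then (1 : ℝ) else 0) =
      if IsCopy H G v then ((S.filter fun i => ¬ (G.comap v).IsIsolated i).card : ℝ) *
        ((S.filter fun i => ¬ (G.comap v).IsIsolated i).card - 1) else 0 := by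
    intro S v
    by_cases hv : IsCopy H G v
    · simp only [hv, true_and, if_true]
      rw [Finset.sum_boole]
      have : (S.offDiag.filter fun p => ¬ (G.comap v).IsIsolated p.1 ∧
          ¬ (G.comap v).IsIsolated p.2) =
          (S.filter fun i => ¬ (G.comap v).IsIsolated i).offDiag := by
        ext p
        simp only [Finset.mem_filter, Finset.mem_offDiag]
        tauto
      rw [this, Finset.offDiag_card, Nat.cast_sub (Nat.le_mul_self _)]
      push_cast
      ring
    · simp [hv]
  have hE2 : (𝔼 v, if IsCopy H G v then X v * (X v - 1) else 0) ≤ μ ^ 2 * f := by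
    have h1 := expect_sum_offDiag (V := V) (k := k) (fun v i j => if IsCopy H G v ∧
      ¬ (G.comap v).IsIsolated i ∧ ¬ (G.comap v).IsIsolated j then (1 : ℝ) else 0)
      (fun v σ i j => by simp only [isCopy_comp_perm, not_isIsolated_comp_perm]) Δ
    have h2 : (𝔼 v, ∑ p ∈ (Finset.univ : Finset (Fin k)).offDiag, if IsCopy H G v ∧
        ¬ (G.comap v).IsIsolated p.1 ∧ ¬ (G.comap v).IsIsolated p.2 then (1 : ℝ) else 0) =
        m * (m - 1) * f := by
      rw [hfE, Finset.mul_expect]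
      refine Finset.expect_congr rfl fun v _ => ?_
      rw [hoff]
      by_cases hv : IsCopy H G v
      · simp only [hv, if_true, hv.card_not_isIsolated, ← hm, mul_one]
      · simp [hv]
    rw [h2, Finset.expect_congr rfl fun v _ => hoff Δ v] at h1
    have hr : (Δ.card : ℝ) ≤ k := by
      exact_mod_cast (Finset.card_le_univ Δ).trans_eq (Fintype.card_fin k)
    have hr0 : (0 : ℝ) ≤ Δ.card := by positivity
    refine le_of_mul_le_mul_left ?_ (mul_pos (mul_pos hk0 hk0) hk1)
    calc (k : ℝ) * k * (k - 1) * 𝔼 v, (if IsCopy H G v then X v * (X v - 1) else 0)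
        = k * (k * (k - 1) * 𝔼 v, (if IsCopy H G v then X v * (X v - 1) else 0)) := by ring
      _ = (Δ.card * m * f) * (k * (Δ.card - 1) * (m - 1)) := by rw [h1]; ring
      _ ≤ (Δ.card * m * f) * (Δ.card * (k - 1) * m) := by
          rcases hm0.eq_or_lt with h0 | h0
          · simp [← h0]
          have hm1 : (1 : ℝ) ≤ m := by
            rw [hm] at h0 ⊢
            have : 0 < numNonIsolated H := by exact_mod_cast h0
            exact_mod_cast this
          gcongr ?_ * ?_
          have h3 : (k : ℝ) * (Δ.card - 1) ≤ Δ.card * (k - 1) := by linarith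
          calc (k : ℝ) * (Δ.card - 1) * (m - 1) ≤ Δ.card * (k - 1) * (m - 1) := by
                gcongr
            _ ≤ _ := by gcongr; linarith
      _ = (Δ.card * m) ^ 2 * (k - 1) * f := by ring
      _ = (μ * k) ^ 2 * (k - 1) * f := by rw [hμ]
      _ = _ := by ring
  calc d ^ 2 * prob (fun v => IsCopy H G v ∧ d ≤ |X v - μ|)
      ≤ 𝔼 v, ((if IsCopy H G v then X v * (X v - 1) else 0) +
          (1 - 2 * μ) * (if IsCopy H G v then X v else 0) +
          μ ^ 2 * if IsCopy H G v then 1 else 0) := by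
        rw [prob_eq_expect, Finset.mul_expect]
        refine expect_mono fun v => ?_
        by_cases hv : IsCopy H G v
        · simp only [hv, true_and, if_true]
          split_ifs with h
          · have := pow_le_pow_left₀ hd h 2
            rw [sq_abs] at this
            linarith
          · nlinarith [sq_nonneg (X v - μ)]
        · simp [hv]
    _ = (𝔼 v, if IsCopy H G v then X v * (X v - 1) else 0) + (1 - 2 * μ) * (μ * f) + μ ^ 2 * f := by
        rw [Finset.expect_add_distrib, Finset.expect_add_distrib, ← Finset.mul_expect,
          ← Finset.mul_expect, hE1, ← hfE]
    _ ≤ μ * f := by linarith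

open Classical in
/-- In a random copy of `H`, few non-isolated vertices in a small set of positions have all their
neighbours there: give each ordered pair of neighbours the weight `1 / deg`, so that such a vertex
receives total weight `1` from the pairs inside the set. -/
theorem prob_exists_neighbors_subset_le (hk : 2 ≤ k) (Δ : Finset (Fin k)) {μ : ℝ}
    (hμ : μ * k = Δ.card * numNonIsolated H) :
    numNonIsolated H * prob (fun v => IsCopy H G v ∧ ∃ i ∈ Δ, ¬ (G.comap v).IsIsolated i ∧
      ∀ j, G.Adj (v i) (v j) → j ∈ Δ) ≤ μ ^ 2 * copyProb H G := by
  have hk0 : (0 : ℝ) < k := by exact_mod_cast (by omega : 0 < k)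
  have hk1 : (0 : ℝ) < (k : ℝ) - 1 := by
    have : (2 : ℝ) ≤ k := by exact_mod_cast hk
    linarith
  set m : ℝ := (numNonIsolated H : ℝ) with hm
  set f := copyProb H G with hf
  have hf0 : 0 ≤ f := prob_nonneg _
  have hm0 : 0 ≤ m := by positivity
  let N : (Fin k → V) → Fin k → Finset (Fin k) := fun v i =>
    Finset.univ.filter fun j => G.Adj (v i) (v j)
  let ω : (Fin k → V) → Fin k → Fin k → ℝ := fun v i j =>
    if IsCopy H G v ∧ G.Adj (v i) (v j) then ((N v i).card : ℝ)⁻¹ else 0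
  have hω0 : ∀ v i j, 0 ≤ ω v i j := fun v i j => by
    simp only [ω]; split_ifs <;> positivity
  have hN : ∀ v (σ : Equiv.Perm (Fin k)) i, (N (v ∘ σ) i).card = (N v (σ i)).card :=
    fun v σ i => Finset.card_equiv σ fun j => by simp [N]
  have hsumN : ∀ v i, IsCopy H G v → ¬ (G.comap v).IsIsolated i → ∑ j ∈ N v i, ω v i j = 1 := by
    intro v i hv hi
    have hpos : 0 < (N v i).card := by
      rw [Finset.card_pos]
      simp only [SimpleGraph.IsIsolated, not_forall, not_not] at hi
      obtain ⟨j, hj⟩ := hi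
      exact ⟨j, by simpa [N] using hj⟩
    rw [Finset.sum_congr rfl (g := fun _ => ((N v i).card : ℝ)⁻¹) fun j hj => if_pos
      ⟨hv, by simpa [N] using hj⟩, Finset.sum_const, nsmul_eq_mul, mul_inv_cancel₀]
    exact_mod_cast hpos.ne'
  have h1 := expect_sum_offDiag (V := V) ω
    (fun v σ i j => by simp only [ω, hN, isCopy_comp_perm, Function.comp_apply]) Δ
  have h2 : (𝔼 v, ∑ p ∈ (Finset.univ : Finset (Fin k)).offDiag, ω v p.1 p.2) ≤ m * f := by
    rw [hf, copyProb, prob_eq_expect, Finset.mul_expect]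
    refine expect_mono fun v => ?_
    calc ∑ p ∈ (Finset.univ : Finset (Fin k)).offDiag, ω v p.1 p.2
        ≤ ∑ p : Fin k × Fin k, ω v p.1 p.2 :=
          Finset.sum_le_sum_of_subset_of_nonneg (Finset.subset_univ _) fun p _ _ => hω0 v _ _
      _ = ∑ i, ∑ j, ω v i j := Fintype.sum_prod_type _
      _ = ∑ i, if IsCopy H G v ∧ ¬ (G.comap v).IsIsolated i then 1 else 0 := by
          refine Finset.sum_congr rfl fun i _ => ?_
          by_cases h : IsCopy H G v ∧ ¬ (G.comap v).IsIsolated i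
          · rw [if_pos h, ← hsumN v i h.1 h.2]
            refine (Finset.sum_subset (Finset.subset_univ _) fun j _ hj => if_neg fun h' => ?_).symm
            exact hj (by simpa [N] using h'.2)
          · rw [if_neg h]
            refine Finset.sum_eq_zero fun j _ => if_neg fun h' => h ⟨h'.1, fun h'' => ?_⟩
            exact h'' j h'.2
      _ ≤ m * if IsCopy H G v then 1 else 0 := by
          by_cases hv : IsCopy H G v
          · simp only [hv, true_and, if_true, Finset.sum_boole, hv.card_not_isIsolated, mul_one,
              hm, le_refl]
          · simp [hv]
  have h3 : prob (fun v => IsCopy H G v ∧ ∃ i ∈ Δ, ¬ (G.comap v).IsIsolated i ∧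
      ∀ j, G.Adj (v i) (v j) → j ∈ Δ) ≤ 𝔼 v, ∑ p ∈ Δ.offDiag, ω v p.1 p.2 := by
    rw [prob_eq_expect]
    refine expect_mono fun v => ?_
    split_ifs with h
    · obtain ⟨hv, i, hi, hiso, hsub⟩ := h
      rw [← hsumN v i hv hiso]
      calc ∑ j ∈ N v i, ω v i j
          = ∑ p ∈ (N v i).map ⟨fun j => (i, j), Prod.mk_right_injective i⟩, ω v p.1 p.2 := by
            rw [Finset.sum_map]; rfl
        _ ≤ _ := by
            refine Finset.sum_le_sum_of_subset_of_nonneg (fun p hp => ?_) fun p _ _ => hω0 v _ _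
            obtain ⟨j, hj, rfl⟩ := Finset.mem_map.1 hp
            have hij : G.Adj (v i) (v j) := by simpa [N] using hj
            refine Finset.mem_offDiag.2 ⟨hi, hsub j hij, fun h => ?_⟩
            have h : i = j := h
            exact G.irrefl (h ▸ hij)
    · exact Finset.sum_nonneg fun p _ => hω0 v _ _
  have hr : (Δ.card : ℝ) ≤ k := by
    exact_mod_cast (Finset.card_le_univ Δ).trans_eq (Fintype.card_fin k)
  have hr0 : (0 : ℝ) ≤ Δ.card := by positivity
  rcases Nat.eq_zero_or_pos Δ.card with hc | hc
  · have hΔ : Δ = ∅ := Finset.card_eq_zero.1 hc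
    rw [prob_false fun v h => by simp [hΔ] at h, mul_zero]
    positivity
  have hr1 : (0 : ℝ) ≤ (Δ.card : ℝ) - 1 := by
    have : (1 : ℝ) ≤ Δ.card := by exact_mod_cast hc
    linarith
  refine (mul_le_mul_of_nonneg_left h3 hm0).trans ?_
  refine le_of_mul_le_mul_left ?_ (mul_pos (mul_pos hk0 hk0) hk1)
  calc (k : ℝ) * k * (k - 1) * (m * 𝔼 v, ∑ p ∈ Δ.offDiag, ω v p.1 p.2)
      = k * m * (k * (k - 1) * 𝔼 v, ∑ p ∈ Δ.offDiag, ω v p.1 p.2) := by ring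
    _ ≤ k * m * (Δ.card * (Δ.card - 1) * (m * f)) := by
        rw [h1]; gcongr
    _ = (Δ.card * m ^ 2 * f) * (k * (Δ.card - 1)) := by ring
    _ ≤ (Δ.card * m ^ 2 * f) * (Δ.card * (k - 1)) :=
        mul_le_mul_of_nonneg_left (by linarith) (by positivity)
    _ = (Δ.card * m) ^ 2 * (k - 1) * f := by ring
    _ = (μ * k) ^ 2 * (k - 1) * f := by rw [hμ]
    _ = _ := by ring

/-- In a window of random positions that contains about `20` of the non-isolated vertices of a
copy, these are with high probability exactly the vertices with a neighbour outside the window;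
conditioned on the part outside, their number is binomial and determined by the sequence of
vertices with a neighbour in that part. -/
theorem copyProb_le_of_le_numNonIsolated [Nonempty V] (hm : 100000 ≤ numNonIsolated H)
    (hk : 4000 * numNonIsolated H ≤ k) : copyProb H G ≤ 0.3 := by
  classical
  set m := numNonIsolated H with hmdef
  have hm' : (100000 : ℝ) ≤ m := by exact_mod_cast hm
  have hk' : (4000 : ℝ) * m ≤ k := by exact_mod_cast hk
  have hm0 : (0 : ℝ) < m := by linarith
  have hk0 : (0 : ℝ) < k := by linarith
  -- The length of the window makes the expected number `μ` of non-isolated vertices in it lie in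
  -- `[20, 21]`, so that a deviation below `19` leaves between `2` and `40` of them.
  set r := ⌈20 * (k : ℝ) / m⌉₊ with hr
  have hr1 : 20 * (k : ℝ) / m ≤ r := Nat.le_ceil _
  have hr2 : (r : ℝ) < 20 * (k : ℝ) / m + 1 := Nat.ceil_lt_add_one (by positivity)
  have hr3 : (80000 : ℝ) ≤ r := by
    refine le_trans ?_ hr1
    rw [le_div_iff₀ hm0]
    linarith
  have hrk : r ≤ k := by
    have h1 : 20 * (k : ℝ) / m ≤ 0.5 * k := by
      rw [div_le_iff₀ hm0]; nlinarith
    have : (r : ℝ) ≤ k := by linarith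
    exact_mod_cast this
  obtain ⟨μ, hμ⟩ : ∃ μ : ℝ, μ = r * m / k := ⟨_, rfl⟩
  have hμ1 : 20 ≤ μ := by
    rw [hμ, le_div_iff₀ hk0]
    rwa [div_le_iff₀ hm0] at hr1
  have hμ2 : μ ≤ 21 := by
    rw [hμ, div_le_iff₀ hk0]
    have h2 := mul_lt_mul_of_pos_right hr2 hm0
    have h3 : (20 * (k : ℝ) / m + 1) * m = 20 * k + m := by field_simp
    linarith
  have hμk : μ * k = r * m := by rw [hμ]; field_simp
  clear_value r
  obtain ⟨s, rfl⟩ := Nat.exists_eq_add_of_le' hrk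
  set Δ : Finset (Fin (s + r)) := Finset.univ.map (Fin.natAddEmb s) with hΔ
  have hΔcard : Δ.card = r := by simp [hΔ]
  have hk2 : 2 ≤ s + r := by
    have : 80000 ≤ r := by exact_mod_cast hr3
    omega
  set f := copyProb H G with hf
  have hf0 : 0 ≤ f := prob_nonneg _
  have hdev := sq_mul_prob_deviation_le (G := G) hk2 Δ (H := H) (by rw [hΔcard]; exact hμk)
    (by norm_num : (0 : ℝ) ≤ 19)
  have hhid := prob_exists_neighbors_subset_le (G := G) hk2 Δ (H := H)
    (by rw [hΔcard]; exact hμk)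
  set D : (Fin (s + r) → V) → Prop := fun v =>
    19 ≤ |((Δ.filter fun i => ¬ (G.comap v).IsIsolated i).card : ℝ) - μ| with hD
  set E : (Fin (s + r) → V) → Prop := fun v => ∃ i ∈ Δ, ¬ (G.comap v).IsIsolated i ∧
    ∀ j, G.Adj (v i) (v j) → j ∈ Δ with hE
  -- The window consists of the last `r` positions; the sequence `z` outside it is fixed first.
  have hmain : prob (fun v => (IsCopy H G v ∧ ¬ D v) ∧ ¬ E v) ≤ 0.28 := by
    rw [prob_fin_append]
    refine Finset.expect_le Finset.univ_nonempty fun z _ => ?_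
    set Z := List.ofFn z with hZ
    -- Outside the events `D` and `E`, the non-isolated positions of the window are those of the
    -- vertices in `A`.
    obtain ⟨A, hA⟩ : ∃ A : V → Prop, ∀ u, A u ↔ ¬ IsoTo G u Z := ⟨_, fun _ => Iff.rfl⟩
    have hwin := prob_window_le (G := G) (t := 2 * H.edgeSet.ncard) (r := r) (a := 40)
      (by have : 80000 ≤ r := by exact_mod_cast hr3
          omega) fun u => (hA u).1
    refine le_trans (prob_mono fun w hw => ?_) hwin
    obtain ⟨⟨hcopy, hnD⟩, hnE⟩ := hw
    set v := Fin.append z w with hv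
    have hvΔ : ∀ j, v (Fin.natAdd s j) = w j := fun j => Fin.append_right z w j
    have hvZ : ∀ i, v (Fin.castAdd r i) = z i := fun i => Fin.append_left z w i
    have hiff : ∀ j, ¬ (G.comap v).IsIsolated (Fin.natAdd s j) ↔ A (w j) := by
      intro j
      rw [hA]
      constructor
      · intro hiso
        have h1 : ¬ ∀ l, G.Adj (v (Fin.natAdd s j)) (v l) → l ∈ Δ := fun h => hnE
          ⟨Fin.natAdd s j, by simp [hΔ], hiso, h⟩
        push Not at h1
        obtain ⟨l, hl, hlΔ⟩ := h1
        induction l using Fin.addCases with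
        | left i =>
          rw [hvΔ, hvZ] at hl
          exact fun h => h (z i) (by simp [hZ, List.mem_ofFn]) hl
        | right i => exact absurd (by simp [hΔ]) hlΔ
      · intro h hiso
        refine h fun b hb hadj => ?_
        obtain ⟨i, rfl⟩ := List.mem_ofFn.1 hb
        refine hiso (Fin.castAdd r i) ?_
        rw [SimpleGraph.comap_adj, hvΔ, hvZ]
        exact hadj
    have hcount : (List.ofFn w).countP (fun u => A u) =
        (Δ.filter fun i => ¬ (G.comap v).IsIsolated i).card := by
      rw [countP_ofFn A w, hΔ, Finset.filter_map, Finset.card_map]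
      congr 1
      ext j
      simpa using (hiff j).symm
    have htotal : adjPairs G (List.ofFn w ++ Z) = 2 * H.edgeSet.ncard := by
      rw [← hcopy.total_nil, total, List.append_nil, hv, List.ofFn_fin_append]
      exact adjPairs_perm List.perm_append_comm
    refine ⟨?_, ?_⟩
    · rw [hcount]
      simp only [hD, not_le, abs_lt] at hnD
      constructor
      · have : (1 : ℝ) < (Δ.filter fun i => ¬ (G.comap v).IsIsolated i).card := by linarith
        exact_mod_cast this
      · have : ((Δ.filter fun i => ¬ (G.comap v).IsIsolated i).card : ℝ) < 41 := by
          linarith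
        exact Nat.lt_succ_iff.1 (by exact_mod_cast this)
    · rw [← htotal]
      refine adjPairs_filter_append A fun u hu hnA b hb hadj => ?_
      obtain ⟨j, rfl⟩ := List.mem_ofFn.1 hu
      have hiso := not_not.1 fun h => hnA ((hiff j).1 h)
      rcases List.mem_append.1 hb with hb | hb
      · obtain ⟨l, rfl⟩ := List.mem_ofFn.1 hb
        exact hiso (Fin.natAdd s l) (by rw [SimpleGraph.comap_adj, hvΔ, hvΔ]; exact hadj)
      · obtain ⟨i, rfl⟩ := List.mem_ofFn.1 hb
        exact hiso (Fin.castAdd r i) (by rw [SimpleGraph.comap_adj, hvΔ, hvZ]; exact hadj)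
  have hsplit1 := prob_and_add_prob_and_not (IsCopy H G) D
  have hsplit2 := prob_and_add_prob_and_not (fun v => IsCopy H G v ∧ ¬ D v) E
  have hle : prob (fun v => (IsCopy H G v ∧ ¬ D v) ∧ E v) ≤ prob fun v => IsCopy H G v ∧ E v :=
    prob_mono fun v h => ⟨h.1.1, h.2⟩
  have hfdef : f = prob (IsCopy H G) := rfl
  -- The losses `21 / 19 ^ 2` and `441 / 100000` leave `f ≤ 0.28 / (1 - 0.0627) ≤ 0.3`.
  have hdev' : prob (fun v => IsCopy H G v ∧ D v) ≤ 0.0582 * f := by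
    have h1 : μ * f ≤ 21 * f := by gcongr
    change (19 : ℝ) ^ 2 * prob (fun v => IsCopy H G v ∧ D v) ≤ _ at hdev
    linarith
  have hhid' : prob (fun v => IsCopy H G v ∧ E v) ≤ 0.0045 * f := by
    have h1 : μ ^ 2 * f ≤ 441 * f := by
      gcongr
      nlinarith
    have h2 : (100000 : ℝ) * prob (fun v => IsCopy H G v ∧ E v) ≤
        m * prob (fun v => IsCopy H G v ∧ E v) := by
      gcongr
      exact prob_nonneg _
    change (m : ℝ) * prob (fun v => IsCopy H G v ∧ E v) ≤ _ at hhid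
    linarith
  linarith

end Large

/-! ### From induced densities to random sequences -/

section Limit

variable {k n : ℕ} (H : SimpleGraph (Fin k)) (G : SimpleGraph (Fin n))

/-- Every vertex set that induces a copy of `H` can be enumerated in `k!` ways. -/
theorem card_inducedCopies_mul_factorial_le :
    (inducedCopies H G).card * k.factorial ≤ Nat.card {v : Fin k → Fin n // IsCopy H G v} := by
  classical
  have hmem : ∀ S : {S // S ∈ inducedCopies H G},
      S.1.card = k ∧ Nonempty (G.induce (S.1 : Set (Fin n)) ≃g H) := by
    rintro ⟨S, hS⟩
    simpa [inducedCopies] using hS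
  let e : ∀ S : {S // S ∈ inducedCopies H G}, Fin k ≃ S.1 := fun S =>
    (S.1.equivFinOfCardEq (hmem S).1).symm
  let F : {S // S ∈ inducedCopies H G} × Equiv.Perm (Fin k) →
      {v : Fin k → Fin n // IsCopy H G v} := fun p =>
    ⟨fun i => (e p.1 (p.2 i) : Fin n), by
      obtain ⟨φ⟩ := (hmem p.1).2
      let ψ : G.comap (fun i => (e p.1 (p.2 i) : Fin n)) ≃g
        G.induce (p.1.1 : Set (Fin n)) := ⟨p.2.trans (e p.1), Iff.rfl⟩
      exact ⟨ψ.trans φ⟩⟩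
  have hF : Function.Injective F := by
    rintro ⟨S, σ⟩ ⟨T, τ⟩ h
    have h1 : ∀ i, (e S (σ i) : Fin n) = e T (τ i) := fun i =>
      congrFun (congrArg Subtype.val h) i
    have h2 : S = T := by
      refine Subtype.ext (Finset.ext fun x => ⟨fun hx => ?_, fun hx => ?_⟩)
      · have := h1 (σ.symm ((e S).symm ⟨x, hx⟩))
        simp only [Equiv.apply_symm_apply] at this
        rw [this]
        exact Subtype.prop _
      · have := h1 (τ.symm ((e T).symm ⟨x, hx⟩))
        simp only [Equiv.apply_symm_apply] at this
        rw [← this]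
        exact Subtype.prop _
    subst h2
    refine Prod.ext rfl (Equiv.ext fun i => ?_)
    exact (e S).injective (Subtype.ext (h1 i))
  have := Nat.card_le_card_of_injective F hF
  rwa [Nat.card_prod, Nat.card_eq_fintype_card, Nat.card_eq_fintype_card, Fintype.card_coe,
    Fintype.card_perm, Fintype.card_fin] at this

theorem inducedDensity_mul_le_copyProb (hkn : k ≤ n) (hn : 0 < n) :
    inducedDensity H G * (n.descFactorial k / (n : ℝ) ^ k) ≤ copyProb H G := by
  classical
  have h := card_inducedCopies_mul_factorial_le H G
  have hchoose : (0 : ℝ) < n.choose k := by exact_mod_cast Nat.choose_pos hkn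
  have hprob : copyProb H G = Nat.card {v : Fin k → Fin n // IsCopy H G v} / (n : ℝ) ^ k := by
    rw [copyProb, prob_eq_expect, Fintype.expect_eq_sum_div_card, Finset.sum_boole,
      Nat.card_eq_fintype_card, Fintype.card_subtype]
    simp
  rw [hprob, inducedDensity, Fintype.card_fin, Fintype.card_fin,
    Nat.descFactorial_eq_factorial_mul_choose]
  rw [← mul_div_assoc]
  gcongr
  push_cast
  calc ((inducedCopies H G).card : ℝ) / n.choose k * (k.factorial * n.choose k)
      = (inducedCopies H G).card * k.factorial := by field_simp
    _ ≤ _ := by exact_mod_cast h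

theorem tendsto_descFactorial_div_pow (k : ℕ) :
    Tendsto (fun n : ℕ => (n.descFactorial k : ℝ) / (n : ℝ) ^ k) atTop (𝓝 1) := by
  induction k with
  | zero => simp
  | succ k ih =>
    have h1 : Tendsto (fun n : ℕ => 1 - (k : ℝ) / n) atTop (𝓝 (1 - 0)) :=
      tendsto_const_nhds.sub (tendsto_const_div_atTop_nhds_zero_nat _)
    have h2 := h1.mul ih
    rw [sub_zero, one_mul] at h2
    refine h2.congr' ?_
    filter_upwards [eventually_ge_atTop (k + 1)] with n hn
    have hn0 : (n : ℝ) ≠ 0 := by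
      have : 0 < n := by omega
      positivity
    rw [Nat.descFactorial_succ, Nat.cast_mul, Nat.cast_sub (by omega), pow_succ]
    field_simp

/-- Sampling with replacement does not change the densities in the limit. -/
theorem inducibility_le_of_forall_copyProb_le {c : ℝ}
    (h : ∀ n : ℕ, 0 < n → ∀ G : SimpleGraph (Fin n), copyProb H G ≤ c) :
    inducibility H ≤ c := by
  have h1 := (tendsto_maxInducedDensity H).mul (tendsto_descFactorial_div_pow k)
  rw [mul_one] at h1
  refine le_of_tendsto h1 ?_
  filter_upwards [eventually_ge_atTop (k + 1)] with n hn
  obtain ⟨G, hG⟩ : ∃ G : SimpleGraph (Fin n), inducedDensity H G = maxInducedDensity H n :=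
    exists_eq_ciSup_of_finite
  rw [← hG]
  exact (inducedDensity_mul_le_copyProb H G (by omega) (by omega)).trans (h n (by omega) G)

end Limit

end GraphInducibility

theorem theorem2p3 :
    ∃ α c : ℝ, 0 < α ∧ 2 / Real.exp 1 ^ 2 ≤ c ∧ c < 1 / Real.exp 1 ∧
      ∀ k ℓ : ℕ, 0 < k → 2 ≤ ℓ → ∀ H : SimpleGraph (Fin k),
        H.edgeSet.ncard = ℓ → (GraphInducibility.numNonIsolated H : ℝ) ≤ α * (k : ℝ) →
          GraphInducibility.inducibility H ≤ c := by
  open GraphInducibility in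
  obtain ⟨c, K, hc, hK, hsmall⟩ := exists_copyProb_le_of_numNonIsolated_le 100000
  have he1 := exp_neg_one_gt
  have he2 := exp_neg_one_lt
  have hexp : 1 / Real.exp 1 = Real.exp (-1) := by rw [Real.exp_neg, one_div]
  have hexp2 : 2 / Real.exp 1 ^ 2 = 2 * Real.exp (-1) ^ 2 := by
    rw [← hexp]; ring
  -- Note that `2 / e ^ 2 ≈ 0.2707 ≤ 0.3 < 1 / e`.
  refine ⟨min K⁻¹ 4000⁻¹, max c 0.3, by positivity, ?_, ?_, ?_⟩
  · refine le_max_of_le_right ?_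
    rw [hexp2]
    nlinarith
  · rw [hexp]
    exact max_lt hc (by linarith)
  · intro k ℓ _ hℓ H hH hm
    have hmK : K * numNonIsolated H ≤ k := by
      have h1 : (numNonIsolated H : ℝ) ≤ K⁻¹ * k := hm.trans (by gcongr; exact min_le_left _ _)
      rwa [inv_mul_eq_div, le_div_iff₀' hK] at h1
    have hm4 : 4000 * numNonIsolated H ≤ k := by
      have h1 : (numNonIsolated H : ℝ) ≤ 4000⁻¹ * k :=
        hm.trans (by gcongr; exact min_le_right _ _)
      rw [inv_mul_eq_div, le_div_iff₀' (by norm_num)] at h1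
      exact_mod_cast h1
    refine inducibility_le_of_forall_copyProb_le H fun n hn G => ?_
    have : Nonempty (Fin n) := ⟨⟨0, hn⟩⟩
    rcases le_total (numNonIsolated H) 100000 with h | h
    · exact le_max_of_le_left (hsmall G k H (hH ▸ hℓ) h hmK)
    · exact le_max_of_le_right (copyProb_le_of_le_numNonIsolated h hm4)
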